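/- **Setting.** Let $B_n$ be the braid group with Artin generators $\sigma_1,\dots,\sigma_{n-1}$ and let $\omega(\beta)$ be the exponent sum (writhe) of $\beta\in B_n$. Let $\mathcal A_n$ be the free noncommutative unital ring on $a_{ij}$, $1\le i\ne j\le n$, and let $\phi:B_n\to\operatorname{Aut}\mathcal A_n$ be the homomorphism (with $\phi_{\beta\beta'}=\phi_\beta\circ\phi_{\beta'}$) such that $\phi_{\sigma_k}$ sends $$a_{ij}\mapsto a_{ij},\quad a_{k+1,i}\mapsto a_{ki},\quad a_{i,k+1}\mapsto a_{ik},\quad a_{ki}\mapsto a_{k+1,i}-a_{k+1,k}a_{ki},\quad a_{ik}\mapsto a_{i,k+1}-a_{ik}a_{k,k+1}$$ for $i,j\notin\{k,k+1\}$, and $a_{k,k+1}\mapsto -a_{k+1,k}$, $a_{k+1,k}\mapsto -a_{k,k+1}$. Let $\phi^*_\beta$ be the automorphism of $\mathcal A_{n+1}$ given by $\beta\in B_n\subset B_{n+1}$; the $n\times n$ matrices $\Phi^L_\beta,\Phi^R_\beta$ over $\mathcal A_n$ are defined by $$\phi^*_\beta(a_{i,n+1})=\sum_{j}(\Phi^L_\beta)_{ij}a_{j,n+1},\qquad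 \phi^*_\beta(a_{n+1,i})=\sum_{j}a_{n+1,j}(\Phi^R_\beta)_{ji}.$$ Let $R_0=\mathbb Z[\lambda^{\pm1},\mu^{\pm1}]$, let $\mathbf A$ be the $n\times n$ matrix over $\mathcal A_n\otimes R_0$ with entries $a_{ij}$ for $i<j$, $-\mu a_{ij}$ for $i>j$ and $1-\mu$ for $i=j$, and let $\Lambda=\operatorname{diag}(\lambda\mu^{\omega(\beta)},1,\dots,1)$. An augmentation of the closure $K$ of $\beta\in B_n$ is a unital ring homomorphism $\epsilon:\mathcal A_n\otimes R_0\to\mathbb C$ that vanishes on the two-sided ideal generated by the entries of $\mathbf A-\Lambda\Phi^L_\beta\mathbf A$ and $\mathbf A-\mathbf A\Phi^R_\beta\Lambda^{-1}$. If $\epsilon(\mu)\ne1$, its rank is the rank of the matrix $\epsilon(\mathbf A)$. The augmentation rank $\operatorname{ar}(K)$, computed from the braid representative $\beta$, is the maximal rank of an augmentation with $\epsilon(\mu)\neq 1$. For $\alpha\in B_k$ and $\gamma\in B_p$, let $\gamma(\alpha)\in B_{kp}$ be the braid obtained by replacing each strand of $\alpha$ by $p$ parallel copies (blackboard framing) and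 multiplying on the right by the image of $\gamma$ under $B_p\hookrightarrow B_{kp}$, $\sigma_i\mapsto\sigma_i$. For $n,p>1$, the iterated torus knot $T((n,p),(n+1,1))$, a cable of the $(n,n+1)$ torus knot, is the closure of $\beta=\gamma(\alpha)\in B_{np}$, where $\alpha=(\sigma_1\cdots\sigma_{n-1})^{n+1}\in B_n$ and $\gamma=\sigma_1\cdots\sigma_{p-1}\in B_p$. **Theorem.** For all integers $n>1$ and $p>1$, the knot $T((n,p),(n+1,1))$, presented as the closure of this braid $\beta$, satisfies $$\operatorname{ar}\bigl(T((n,p),(n+1,1))\bigr)<np .$$ Moreover, there is no unital ring homomorphism $\epsilon:\mathcal A_{np}\to\mathbb C$ with $\epsilon(\Phi^L_\beta)=\Delta(\beta)$, where $\Delta(\beta)=\operatorname{diag}\bigl((-1)^{\omega(\beta)},1,\dots,1\bigr)$. -/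

import Mathlib

/-! ### Braid groups -/

/-- Artin's relations on the generators `σ_1, …, σ_{n-1}` (indexed here from `0`). -/
def braidRels (n : ℕ) : Set (FreeGroup (Fin (n - 1))) :=
  {r | ∃ i j : Fin (n - 1), (i : ℕ) + 2 ≤ j ∧
      r = FreeGroup.of i * FreeGroup.of j * (FreeGroup.of j * FreeGroup.of i)⁻¹} ∪
  {r | ∃ i j : Fin (n - 1), (i : ℕ) + 1 = j ∧
      r = FreeGroup.of i * FreeGroup.of j * FreeGroup.of i *
        (FreeGroup.of j * FreeGroup.of i * FreeGroup.of j)⁻¹}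

/-- The braid group `B_n` on `n` strands. -/
abbrev BraidGroup (n : ℕ) : Type := PresentedGroup (braidRels n)

namespace BraidGroup

/-- The Artin generator `σ_{i+1}` of `B_n`. -/
def sigma {n : ℕ} (i : Fin (n - 1)) : BraidGroup n := PresentedGroup.of i

theorem sigma_comm {n : ℕ} (i j : Fin (n - 1)) (h : (i : ℕ) + 2 ≤ j) :
    (sigma i * sigma j : BraidGroup n) = sigma j * sigma i := by
  have := PresentedGroup.one_of_mem (rels := braidRels n) (Or.inl ⟨i, j, h, rfl⟩)
  rw [map_mul, map_inv, mul_inv_eq_one] at this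
  simpa [sigma, PresentedGroup.of] using this

theorem sigma_braid {n : ℕ} (i j : Fin (n - 1)) (h : (i : ℕ) + 1 = j) :
    (sigma i * sigma j * sigma i : BraidGroup n) = sigma j * sigma i * sigma j := by
  have := PresentedGroup.one_of_mem (rels := braidRels n) (Or.inr ⟨i, j, h, rfl⟩)
  rw [map_mul, map_inv, mul_inv_eq_one] at this
  simpa [sigma, PresentedGroup.of] using this

/-- A homomorphism out of `B_n` is given by images of the generators that satisfy
Artin's relations. -/
def lift {n : ℕ} {G : Type*} [Group G] (f : Fin (n - 1) → G)
    (hc : ∀ i j : Fin (n - 1), (i : ℕ) + 2 ≤ j → f i * f j = f j * f i)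
    (hb : ∀ i j : Fin (n - 1), (i : ℕ) + 1 = j → f i * f j * f i = f j * f i * f j) :
    BraidGroup n →* G :=
  PresentedGroup.toGroup (f := f) (by
    rintro r (⟨i, j, h, rfl⟩ | ⟨i, j, h, rfl⟩)
    · simp only [map_mul, map_inv, FreeGroup.lift_apply_of]
      rw [mul_inv_eq_one]; exact hc i j h
    · simp only [map_mul, map_inv, FreeGroup.lift_apply_of]
      rw [mul_inv_eq_one]; exact hb i j h)

@[simp] theorem lift_sigma {n : ℕ} {G : Type*} [Group G] (f : Fin (n - 1) → G) (hc) (hb)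
    (i : Fin (n - 1)) : lift f hc hb (sigma i) = f i :=
  PresentedGroup.toGroup.of _

theorem induction {n : ℕ} {P : BraidGroup n → Prop} (one : P 1)
    (gen : ∀ i, P (sigma i)) (inv : ∀ i, P (sigma i)⁻¹)
    (mul : ∀ x y, P x → P y → P (x * y)) (β : BraidGroup n) : P β := by
  obtain ⟨w, rfl⟩ := PresentedGroup.mk_surjective (braidRels n) β
  induction w using FreeGroup.induction_on with
  | C1 => simpa using one
  | of i => exact gen i
  | inv_of i _ => rw [map_inv]; exact inv i
  | mul x y hx hy => rw [map_mul]; exact mul _ _ hx hy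

/-- The writhe (algebraic length) of a braid, as a homomorphism. -/
def writheHom (n : ℕ) : BraidGroup n →* Multiplicative ℤ :=
  lift (fun _ => Multiplicative.ofAdd 1) (fun _ _ _ => rfl) (fun _ _ _ => rfl)

/-- The writhe (algebraic length) of a braid. -/
def writhe {n : ℕ} (β : BraidGroup n) : ℤ := (writheHom n β).toAdd

/-- The inclusion `B_m → B_n`, `σ_i ↦ σ_i`, for `m ≤ n`. -/
def incl {m n : ℕ} (h : m ≤ n) : BraidGroup m →* BraidGroup n :=
  lift (fun i => sigma (Fin.castLE (by omega) i))
    (fun i j hij => sigma_comm _ _ (by simpa using hij))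
    (fun i j hij => sigma_braid _ _ (by simpa using hij))

/-- The generators of `B_n` indexed by natural numbers; `1` outside of the range. -/
def sigmaNat (n i : ℕ) : BraidGroup n := if h : i < n - 1 then sigma ⟨i, h⟩ else 1

/-- `s_a s_{a+1} ⋯ s_{a+l-1}`: for Artin generators, one strand crosses the `l` strands below
it. -/
def strandCross {G : Type*} [Group G] (s : ℕ → G) (a : ℕ) : ℕ → G
  | 0 => 1
  | l + 1 => strandCross s a l * s (a + l)

/-- `m` adjacent parallel strands, in positions `a, …, a+m-1`, cross the `l` strands in positions
`a+m, …, a+m+l-1`, every two of them once and with the same sign as in `s`. The lowest of the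
`m` strands goes first. -/
def blockCross {G : Type*} [Group G] (s : ℕ → G) (a : ℕ) : ℕ → ℕ → G
  | 0, _ => 1
  | m + 1, l => strandCross s (a + m) l * blockCross s a m l

section Blocks

variable {G : Type*} [Group G] {s : ℕ → G}

theorem strandCross_comm {a l : ℕ} {x : G}
    (hx : ∀ i, a ≤ i → i < a + l → Commute x (s i)) : Commute x (strandCross s a l) := by
  induction l with
  | zero => exact Commute.one_right x
  | succ l ih =>
    exact (ih fun i h1 h2 => hx i h1 (by omega)).mul_right (hx _ (by omega) (by omega))

theorem blockCross_comm {a m l : ℕ} {x : G}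
    (hx : ∀ i, a ≤ i → i + 1 < a + m + l → Commute x (s i)) :
    Commute x (blockCross s a m l) := by
  induction m with
  | zero => exact Commute.one_right x
  | succ m ih =>
    exact (strandCross_comm fun i h1 h2 => hx i (by omega) (by omega)).mul_right
      (ih fun i h1 h2 => hx i h1 (by omega))

theorem strandCross_add (a l l2 : ℕ) :
    strandCross s a (l + l2) = strandCross s a l * strandCross s (a + l) l2 := by
  induction l2 with
  | zero => simp [strandCross]
  | succ k ih =>
    rw [← Nat.add_assoc, strandCross, ih, strandCross, mul_assoc, Nat.add_assoc]

theorem blockCross_add (hc : ∀ i j, i + 2 ≤ j → s i * s j = s j * s i) (a m l l2 : ℕ) :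
    blockCross s a m (l + l2) = blockCross s a m l * blockCross s (a + l) m l2 := by
  induction m with
  | zero => simp [blockCross]
  | succ m ih =>
    have h : Commute (strandCross s (a + m + l) l2) (blockCross s a m l) := by
      refine blockCross_comm fun i h1 h2 => ?_
      refine (strandCross_comm fun j h3 h4 => ?_).symm
      exact hc i j (by omega)
    simp only [blockCross]
    rw [strandCross_add, ih, mul_assoc, ← mul_assoc (strandCross s (a + m + l) l2), h.eq,
      show a + l + m = a + m + l by omega]
    simp only [mul_assoc]

theorem strandCross_slide (hc : ∀ i j, i + 2 ≤ j → s i * s j = s j * s i) {N : ℕ}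
    (hb : ∀ i, i + 1 < N → s i * s (i + 1) * s i = s (i + 1) * s i * s (i + 1)) {a l j : ℕ}
    (hN : a + l ≤ N) (h1 : a ≤ j) (h2 : j + 1 < a + l) :
    s (j + 1) * strandCross s a l = strandCross s a l * s j := by
  induction l with
  | zero => omega
  | succ l ih =>
    by_cases h : j + 1 < a + l
    · rw [strandCross, ← mul_assoc, ih (by omega) h, mul_assoc, hc j (a + l) (by omega), mul_assoc]
    · obtain ⟨t, rfl⟩ : ∃ t, l = t + 1 := ⟨l - 1, by omega⟩
      obtain rfl : j = a + t := by omega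
      have hcm : Commute (s (a + t + 1)) (strandCross s a t) :=
        strandCross_comm fun i h3 h4 => (hc i (a + t + 1) (by omega)).symm
      simp only [strandCross, ← Nat.add_assoc]
      calc s (a + t + 1) * (strandCross s a t * s (a + t) * s (a + t + 1))
          = strandCross s a t * (s (a + t + 1) * s (a + t) * s (a + t + 1)) := by
            simp only [← mul_assoc]; rw [hcm.eq]
        _ = _ := by rw [← hb (a + t) (by omega)]; simp only [mul_assoc]

theorem blockCross_slide (hc : ∀ i j, i + 2 ≤ j → s i * s j = s j * s i) {N : ℕ}
    (hb : ∀ i, i + 1 < N → s i * s (i + 1) * s i = s (i + 1) * s i * s (i + 1)) {a m l j : ℕ}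
    (hN : a + m + l ≤ N + 1) (h1 : a ≤ j) (h2 : j + 1 < a + l) :
    s (j + m) * blockCross s a m l = blockCross s a m l * s j := by
  induction m with
  | zero => simp [blockCross]
  | succ m ih =>
    rw [blockCross, ← mul_assoc, ← Nat.add_assoc,
      strandCross_slide hc hb (by omega) (by omega) (by omega), mul_assoc, ih (by omega), mul_assoc]

theorem blockCross_slide_strand (hc : ∀ i j, i + 2 ≤ j → s i * s j = s j * s i) {N : ℕ}
    (hb : ∀ i, i + 1 < N → s i * s (i + 1) * s i = s (i + 1) * s i * s (i + 1))
    {a m l c t : ℕ} (hN : a + m + l ≤ N + 1) (h1 : a ≤ c) (h2 : c + t < a + l) :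
    strandCross s (c + m) t * blockCross s a m l = blockCross s a m l * strandCross s c t := by
  induction t with
  | zero => simp [strandCross]
  | succ t ih =>
    rw [strandCross, strandCross, mul_assoc, show c + m + t = c + t + m by omega,
      blockCross_slide hc hb hN (by omega) (by omega), ← mul_assoc, ih (by omega), mul_assoc]

theorem blockCross_slide_block (hc : ∀ i j, i + 2 ≤ j → s i * s j = s j * s i) {N : ℕ}
    (hb : ∀ i, i + 1 < N → s i * s (i + 1) * s i = s (i + 1) * s i * s (i + 1))
    {a m l c t u : ℕ} (hN : a + m + l ≤ N + 1) (h1 : a ≤ c) (h2 : c + u + t ≤ a + l) :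
    blockCross s (c + m) u t * blockCross s a m l = blockCross s a m l * blockCross s c u t := by
  induction u with
  | zero => simp [blockCross]
  | succ u ih =>
    rw [blockCross, blockCross, mul_assoc, ih (by omega), ← mul_assoc,
      show c + m + u = c + u + m by omega,
      blockCross_slide_strand hc hb hN (by omega) (by omega), mul_assoc]

theorem blockCross_braid (hc : ∀ i j, i + 2 ≤ j → s i * s j = s j * s i) {N : ℕ}
    (hb : ∀ i, i + 1 < N → s i * s (i + 1) * s i = s (i + 1) * s i * s (i + 1))
    (a p : ℕ) (hN : a + 3 * p ≤ N + 1) :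
    blockCross s a p p * blockCross s (a + p) p p * blockCross s a p p =
      blockCross s (a + p) p p * blockCross s a p p * blockCross s (a + p) p p := by
  rw [mul_assoc (blockCross s (a + p) p p), ← blockCross_add hc,
    blockCross_slide_block hc hb (by omega) le_rfl (by omega)]

end Blocks

theorem sigmaNat_comm (n i j : ℕ) (h : i + 2 ≤ j) :
    sigmaNat n i * sigmaNat n j = sigmaNat n j * sigmaNat n i := by
  unfold sigmaNat
  by_cases hj : j < n - 1
  · have hi : i < n - 1 := by omega
    rw [dif_pos hi, dif_pos hj]
    exact sigma_comm _ _ h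
  · rw [dif_neg hj]; simp

theorem sigmaNat_braid (n i : ℕ) (h : i + 1 < n - 1) :
    sigmaNat n i * sigmaNat n (i + 1) * sigmaNat n i =
      sigmaNat n (i + 1) * sigmaNat n i * sigmaNat n (i + 1) := by
  unfold sigmaNat
  rw [dif_pos h, dif_pos (show i < n - 1 by omega)]
  exact sigma_braid _ _ rfl

/-- The `p`-parallel of a braid in the blackboard framing: every strand is replaced by `p`
parallel copies. -/
def parallel (k p : ℕ) : BraidGroup k →* BraidGroup (k * p) :=
  lift (fun i => blockCross (sigmaNat (k * p)) (i * p) p p)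
    (fun i j hij => by
      have hp : ((i : ℕ) + 2) * p ≤ j * p := Nat.mul_le_mul_right p hij
      have hp2 : ((i : ℕ) + 2) * p = i * p + 2 * p := by ring
      refine (blockCross_comm fun b h1 h2 => ?_).eq
      refine (blockCross_comm fun a h3 h4 => ?_).symm
      exact (sigmaNat_comm _ a b (by omega)).symm)
    (fun i j hij => by
      have hj : (j : ℕ) * p = i * p + p := by rw [← hij]; ring
      have hk : ((i : ℕ) + 3) * p ≤ k * p := Nat.mul_le_mul_right p (by omega)
      have hk2 : ((i : ℕ) + 3) * p = i * p + 3 * p := by ring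
      rw [hj]
      exact blockCross_braid (N := k * p - 1) (sigmaNat_comm _) (sigmaNat_braid _) _ _ (by omega))

/-- The braid `γ(α) ∈ B_{kp}` whose closure is the braid satellite `K(α, γ)` of the closure `K`
of `α ∈ B_k` with pattern `γ ∈ B_p`: the `p`-parallel of `α` followed by `γ` on the first `p`
strands. -/
def satellite {k p : ℕ} (hk : 0 < k) (α : BraidGroup k) (γ : BraidGroup p) :
    BraidGroup (k * p) :=
  parallel k p α * incl (Nat.le_mul_of_pos_left p hk) γ

/-- The torus braid `(σ_1 σ_2 ⋯ σ_{n-1})^q`. -/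
def torus (n : ℕ) (q : ℤ) : BraidGroup n :=
  (List.ofFn fun i : Fin (n - 1) => (sigma i : BraidGroup n)).prod ^ q

end BraidGroup

/-! ### The action of the braid group on the cord algebra -/

namespace CordAlgebra

/-- The free noncommutative unital ring `𝒜_n` on the generators `a_{ij}`, `i ≠ j`. -/
abbrev A (n : ℕ) : Type := FreeAlgebra ℤ {q : Fin n × Fin n // q.1 ≠ q.2}

/-- The generator `a_{ij}` for `i ≠ j` (and `0` if `i = j`). -/
noncomputable def a {n : ℕ} (i j : Fin n) : A n :=
  if h : i ≠ j then FreeAlgebra.ι ℤ ⟨(i, j), h⟩ else 0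

/-- The image of `a_{ij}` under `φ_{σ_k}`, where `x = k` and `y = k + 1`. -/
noncomputable def phiGen {n : ℕ} (x y i j : Fin n) : A n :=
  if i = x ∧ j = y then -a y x
  else if i = y ∧ j = x then -a x y
  else if i = y then a x j
  else if j = y then a i x
  else if i = x then a y j - a y x * a x j
  else if j = x then a i y - a i x * a x y
  else a i j

/-- `φ_{σ_k}` as an algebra endomorphism, where `x = k` and `y = k + 1`. -/
noncomputable def phiHom {n : ℕ} (x y : Fin n) : A n →ₐ[ℤ] A n :=
  FreeAlgebra.lift ℤ fun q => phiGen x y q.1.1 q.1.2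

theorem phiHom_a {n : ℕ} (x y : Fin n) {i j : Fin n} (h : i ≠ j) :
    phiHom x y (a i j) = phiGen x y i j := by
  simp [phiHom, a, h]

theorem hom_ext {n : ℕ} {B : Type*} [Ring B] [Algebra ℤ B] {f g : A n →ₐ[ℤ] B}
    (h : ∀ i j, i ≠ j → f (a i j) = g (a i j)) : f = g := by
  apply FreeAlgebra.hom_ext
  funext q
  obtain ⟨⟨i, j⟩, hq⟩ := q
  simpa [a, hq] using h i j hq

theorem phiHom_inv {n : ℕ} {x y : Fin n} (hxy : x ≠ y) :
    (phiHom x y).comp (phiHom y x) = AlgHom.id ℤ (A n) := by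
  apply hom_ext
  intro i j hij
  by_cases h1 : i = x <;> by_cases h2 : i = y <;> by_cases h3 : j = x <;> by_cases h4 : j = y <;>
    simp_all [phiHom_a, phiGen, eq_comm]

theorem phiHom_braid {n : ℕ} {x y z : Fin n} (hxy : x ≠ y) (hyz : y ≠ z) (hxz : x ≠ z) :
    (phiHom x y).comp ((phiHom y z).comp (phiHom x y)) =
      (phiHom y z).comp ((phiHom x y).comp (phiHom y z)) := by
  apply hom_ext
  intro i j hij
  have hji := hij.symm
  have hi : i = x ∨ i = y ∨ i = z ∨ (i ≠ x ∧ i ≠ y ∧ i ≠ z ∧ x ≠ i ∧ y ≠ i ∧ z ≠ i) := by grind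
  have hj : j = x ∨ j = y ∨ j = z ∨ (j ≠ x ∧ j ≠ y ∧ j ≠ z ∧ x ≠ j ∧ y ≠ j ∧ z ≠ j) := by grind
  rcases hi with rfl | rfl | rfl | ⟨i1, i2, i3, i4, i5, i6⟩ <;> rcases hj with rfl | rfl | rfl | ⟨j1, j2, j3, j4, j5, j6⟩ <;>
    first
      | exact absurd rfl hij
      | (simp [phiHom_a, phiGen, *, hxy.symm, hyz.symm, hxz.symm]; done)
      | (simp [phiHom_a, phiGen, *, hxy.symm, hyz.symm, hxz.symm]; noncomm_ring)

theorem phiHom_comm {n : ℕ} {x y z w : Fin n} (hxy : x ≠ y) (hzw : z ≠ w) (hxz : x ≠ z)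
    (hxw : x ≠ w) (hyz : y ≠ z) (hyw : y ≠ w) :
    (phiHom x y).comp (phiHom z w) = (phiHom z w).comp (phiHom x y) := by
  apply hom_ext
  intro i j hij
  have hji := hij.symm
  have hi : i = x ∨ i = y ∨ i = z ∨ i = w ∨ (i ≠ x ∧ i ≠ y ∧ i ≠ z ∧ i ≠ w ∧ x ≠ i ∧ y ≠ i ∧ z ≠ i ∧ w ≠ i) := by grind
  have hj : j = x ∨ j = y ∨ j = z ∨ j = w ∨ (j ≠ x ∧ j ≠ y ∧ j ≠ z ∧ j ≠ w ∧ x ≠ j ∧ y ≠ j ∧ z ≠ j ∧ w ≠ j) := by grind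
  rcases hi with rfl | rfl | rfl | rfl | ⟨i1, i2, i3, i4, i5, i6, i7, i8⟩ <;> rcases hj with rfl | rfl | rfl | rfl | ⟨j1, j2, j3, j4, j5, j6, j7, j8⟩ <;>
    first
      | exact absurd rfl hij
      | (simp [phiHom_a, phiGen, *, hxy.symm, hzw.symm, hxz.symm, hxw.symm, hyz.symm, hyw.symm]; done)
      | (simp [phiHom_a, phiGen, *, hxy.symm, hzw.symm, hxz.symm, hxw.symm, hyz.symm, hyw.symm]; noncomm_ring)

/-- `φ_{σ_k}` as an automorphism, where `x = k` and `y = k + 1`; its inverse is the same map with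
`x` and `y` exchanged. -/
noncomputable def phiEquiv {n : ℕ} (x y : Fin n) (h : x ≠ y) : A n ≃ₐ[ℤ] A n :=
  AlgEquiv.ofAlgHom (phiHom x y) (phiHom y x) (phiHom_inv h) (phiHom_inv h.symm)

/-- The upper one of the two strands that the `i`-th generator crosses. -/
def lo {n : ℕ} (i : Fin (n - 1)) : Fin n := ⟨i, by omega⟩

/-- The lower one of the two strands that the `i`-th generator crosses. -/
def hi {n : ℕ} (i : Fin (n - 1)) : Fin n := ⟨i + 1, by omega⟩

theorem lo_ne_hi {n : ℕ} (i : Fin (n - 1)) : lo i ≠ hi i := by simp [lo, hi]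

/-- The action `φ : B_n → Aut 𝒜_n`. -/
noncomputable def phi (n : ℕ) : BraidGroup n →* (A n ≃ₐ[ℤ] A n) :=
  BraidGroup.lift (fun i => phiEquiv (lo i) (hi i) (lo_ne_hi i))
    (fun i j hij => by
      have hc := phiHom_comm (lo_ne_hi i) (lo_ne_hi j)
        (by simp only [lo, ne_eq, Fin.ext_iff]; omega)
        (by simp only [lo, hi, ne_eq, Fin.ext_iff]; omega)
        (by simp only [lo, hi, ne_eq, Fin.ext_iff]; omega)
        (by simp only [hi, ne_eq, Fin.ext_iff]; omega)
      ext1 u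
      exact congrArg (fun f : A n →ₐ[ℤ] A n => f u) hc)
    (fun i j hij => by
      have hh : hi i = lo j := by simp only [lo, hi, Fin.ext_iff]; omega
      have hb := phiHom_braid (lo_ne_hi i) (z := hi j)
        (by simp only [hi, ne_eq, Fin.ext_iff]; omega)
        (by simp only [lo, hi, ne_eq, Fin.ext_iff]; omega)
      rw [hh] at hb
      ext1 u
      have hu := congrArg (fun f : A n →ₐ[ℤ] A n => f u) hb
      simpa [phiEquiv, hh] using hu)

theorem phi_sigma {n : ℕ} (i : Fin (n - 1)) (u : A n) :
    phi n (BraidGroup.sigma i) u = phiHom (lo i) (hi i) u := by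
  simp [phi, phiEquiv]

theorem phi_sigma_inv {n : ℕ} (i : Fin (n - 1)) (u : A n) :
    phi n (BraidGroup.sigma i)⁻¹ u = phiHom (hi i) (lo i) u := by
  rw [map_inv]
  simp only [phi, BraidGroup.lift_sigma]
  rfl

/-- `φ*_β`: the action of `β ∈ B_n` on `𝒜_{n+1}` through the inclusion `B_n → B_{n+1}`. -/
noncomputable def phiStar {n : ℕ} (β : BraidGroup n) : A (n + 1) ≃ₐ[ℤ] A (n + 1) :=
  phi (n + 1) (BraidGroup.incl n.le_succ β)

/-- The inclusion `𝒜_n → 𝒜_{n+1}`, `a_{ij} ↦ a_{ij}`. -/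
noncomputable def emb (n : ℕ) : A n →ₐ[ℤ] A (n + 1) :=
  FreeAlgebra.lift ℤ fun q => a q.1.1.castSucc q.1.2.castSucc

theorem emb_a {n : ℕ} (i j : Fin n) : emb n (a i j) = a i.castSucc j.castSucc := by
  by_cases h : i = j <;> simp [emb, a, h]

theorem phiHom_emb {n : ℕ} (x y : Fin n) :
    (phiHom x.castSucc y.castSucc).comp (emb n) = (emb n).comp (phiHom x y) := by
  apply hom_ext
  intro i j hij
  have h : i.castSucc ≠ j.castSucc := by simpa using hij
  simp only [AlgHom.comp_apply, emb_a, phiHom_a _ _ hij, phiHom_a _ _ h, phiGen,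
    Fin.castSucc_inj]
  split_ifs <;> simp [emb_a]

theorem phiStar_sigma {n : ℕ} (i : Fin (n - 1)) (u : A (n + 1)) :
    phiStar (BraidGroup.sigma i) u = phiHom (lo i).castSucc (hi i).castSucc u := by
  simp only [phiStar, BraidGroup.incl, BraidGroup.lift_sigma, phi_sigma]
  rfl

theorem phiStar_sigma_inv {n : ℕ} (i : Fin (n - 1)) (u : A (n + 1)) :
    phiStar (BraidGroup.sigma i)⁻¹ u = phiHom (hi i).castSucc (lo i).castSucc u := by
  simp only [phiStar, BraidGroup.incl, map_inv, BraidGroup.lift_sigma]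
  rw [← map_inv, phi_sigma_inv]
  rfl

theorem phiStar_mul {n : ℕ} (β γ : BraidGroup n) (u : A (n + 1)) :
    phiStar (β * γ) u = phiStar β (phiStar γ u) := by
  simp [phiStar]

theorem phiStar_emb {n : ℕ} (β : BraidGroup n) (u : A n) :
    phiStar β (emb n u) = emb n (phi n β u) := by
  induction β using BraidGroup.induction generalizing u with
  | one => simp [phiStar]
  | gen i =>
    rw [phiStar_sigma, phi_sigma]
    exact congrArg (fun f : A n →ₐ[ℤ] A (n + 1) => f u) (phiHom_emb (lo i) (hi i))
  | inv i =>
    rw [phiStar_sigma_inv, phi_sigma_inv]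
    exact congrArg (fun f : A n →ₐ[ℤ] A (n + 1) => f u) (phiHom_emb (hi i) (lo i))
  | mul x y hx hy => rw [phiStar_mul, hy, hx, map_mul]; rfl

/-- `M` is the matrix of left coefficients of `f`:
`f(a_{i,n+1}) = ∑_j M_{ij} a_{j,n+1}` with `M_{ij} ∈ 𝒜_n`. -/
def IsLeftMatrix {n : ℕ} (f : A (n + 1) → A (n + 1)) (M : Matrix (Fin n) (Fin n) (A n)) : Prop :=
  ∀ i, f (a i.castSucc (Fin.last n)) = ∑ j, emb n (M i j) * a j.castSucc (Fin.last n)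

/-- `M` is the matrix of right coefficients of `f`:
`f(a_{n+1,i}) = ∑_j a_{n+1,j} M_{ji}` with `M_{ji} ∈ 𝒜_n`. -/
def IsRightMatrix {n : ℕ} (f : A (n + 1) → A (n + 1)) (M : Matrix (Fin n) (Fin n) (A n)) : Prop :=
  ∀ i, f (a (Fin.last n) i.castSucc) = ∑ j, a (Fin.last n) j.castSucc * emb n (M j i)

theorem exists_left_phiHom {n : ℕ} {x y : Fin n} (h : x ≠ y) :
    ∃ M, IsLeftMatrix (phiHom x.castSucc y.castSucc) M := by
  refine ⟨fun i j => if i = y then (if j = x then 1 else 0) else if i = x then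
    ((if j = y then 1 else 0) - (if j = x then a y x else 0)) else if j = i then 1 else 0, ?_⟩
  intro i
  have hi : i.castSucc ≠ Fin.last n := (Fin.castSucc_lt_last i).ne
  have hy : Fin.last n ≠ y.castSucc := (Fin.castSucc_lt_last y).ne'
  have hx : Fin.last n ≠ x.castSucc := (Fin.castSucc_lt_last x).ne'
  rw [phiHom_a _ _ hi]
  by_cases h1 : i = y
  · subst h1
    simp [phiGen, hx, hy, h.symm, apply_ite (emb n), ite_mul]
  · by_cases h2 : i = x
    · subst h2
      simp [phiGen, hx, hy, h, apply_ite (emb n), ite_mul, sub_mul, emb_a, Finset.sum_sub_distrib]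
    · simp [phiGen, hx, hy, h1, h2, apply_ite (emb n), ite_mul]

theorem exists_right_phiHom {n : ℕ} {x y : Fin n} (h : x ≠ y) :
    ∃ M, IsRightMatrix (phiHom x.castSucc y.castSucc) M := by
  refine ⟨fun j i => if i = y then (if j = x then 1 else 0) else if i = x then
    ((if j = y then 1 else 0) - (if j = x then a x y else 0)) else if j = i then 1 else 0, ?_⟩
  intro i
  have hi : Fin.last n ≠ i.castSucc := (Fin.castSucc_lt_last i).ne'
  have hy : Fin.last n ≠ y.castSucc := (Fin.castSucc_lt_last y).ne'
  have hx : Fin.last n ≠ x.castSucc := (Fin.castSucc_lt_last x).ne'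
  rw [phiHom_a _ _ hi]
  by_cases h1 : i = y
  · subst h1
    simp [phiGen, hx, hy, h.symm, apply_ite (emb n), mul_ite]
  · by_cases h2 : i = x
    · subst h2
      simp [phiGen, hx, hy, h, apply_ite (emb n), mul_ite, mul_sub, emb_a, Finset.sum_sub_distrib]
    · simp [phiGen, hx, hy, h1, h2, apply_ite (emb n), mul_ite]

/-- The chain rule for left coefficients. -/
theorem IsLeftMatrix.mul {n : ℕ} {β γ : BraidGroup n} {M N : Matrix (Fin n) (Fin n) (A n)}
    (hM : IsLeftMatrix (phiStar β) M) (hN : IsLeftMatrix (phiStar γ) N) :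
    IsLeftMatrix (phiStar (β * γ)) (N.map (phi n β) * M) := by
  intro i
  rw [phiStar_mul, hN i, map_sum]
  simp only [map_mul, phiStar_emb, hM _, Matrix.mul_apply, Matrix.map_apply, map_sum,
    Finset.mul_sum, Finset.sum_mul, mul_assoc]
  exact Finset.sum_comm

/-- The chain rule for right coefficients. -/
theorem IsRightMatrix.mul {n : ℕ} {β γ : BraidGroup n} {M N : Matrix (Fin n) (Fin n) (A n)}
    (hM : IsRightMatrix (phiStar β) M) (hN : IsRightMatrix (phiStar γ) N) :
    IsRightMatrix (phiStar (β * γ)) (M * N.map (phi n β)) := by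
  intro i
  rw [phiStar_mul, hN i, map_sum]
  simp only [map_mul, phiStar_emb, hM _, Matrix.mul_apply, Matrix.map_apply, map_sum,
    Finset.mul_sum, Finset.sum_mul, mul_assoc]
  exact Finset.sum_comm

theorem exists_left {n : ℕ} (β : BraidGroup n) : ∃ M, IsLeftMatrix (phiStar β) M := by
  induction β using BraidGroup.induction with
  | one => exact ⟨1, fun i => by simp [phiStar, Matrix.one_apply, apply_ite (emb n)]⟩
  | gen i =>
    obtain ⟨M, hM⟩ := exists_left_phiHom (lo_ne_hi i)
    exact ⟨M, fun j => by rw [phiStar_sigma]; exact hM j⟩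
  | inv i =>
    obtain ⟨M, hM⟩ := exists_left_phiHom (lo_ne_hi i).symm
    exact ⟨M, fun j => by rw [phiStar_sigma_inv]; exact hM j⟩
  | mul x y hx hy =>
    obtain ⟨M, hM⟩ := hx
    obtain ⟨N, hN⟩ := hy
    exact ⟨_, hM.mul hN⟩

theorem exists_right {n : ℕ} (β : BraidGroup n) : ∃ M, IsRightMatrix (phiStar β) M := by
  induction β using BraidGroup.induction with
  | one => exact ⟨1, fun i => by simp [phiStar, Matrix.one_apply, apply_ite (emb n)]⟩
  | gen i =>
    obtain ⟨M, hM⟩ := exists_right_phiHom (lo_ne_hi i)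
    exact ⟨M, fun j => by rw [phiStar_sigma]; exact hM j⟩
  | inv i =>
    obtain ⟨M, hM⟩ := exists_right_phiHom (lo_ne_hi i).symm
    exact ⟨M, fun j => by rw [phiStar_sigma_inv]; exact hM j⟩
  | mul x y hx hy =>
    obtain ⟨M, hM⟩ := hx
    obtain ⟨N, hN⟩ := hy
    exact ⟨_, hM.mul hN⟩

/-- An auxiliary representation of `𝒜_{n+1}` by triangular matrices that reads off the left
coefficient of `a_{j,n+1}`. -/
noncomputable def leftCoeff {n : ℕ} (j : Fin n) : A (n + 1) →ₐ[ℤ] Matrix (Fin 2) (Fin 2) (A n) :=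
  FreeAlgebra.lift ℤ fun q =>
    if h : (q.1.1 : ℕ) < n then
      if k : (q.1.2 : ℕ) < n then !![a ⟨q.1.1, h⟩ ⟨q.1.2, k⟩, 0; 0, 0]
      else if (q.1.1 : ℕ) = j then !![0, 1; 0, 0] else 0
    else 0

theorem leftCoeff_mul {n : ℕ} (j k : Fin n) (u : A n) :
    leftCoeff j (emb n u * a k.castSucc (Fin.last n)) 0 1 = if k = j then u else 0 := by
  have h1 : leftCoeff j (emb n u) 0 0 = u ∧ leftCoeff j (emb n u) 0 1 = 0 := by
    induction u using FreeAlgebra.induction with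
    | grade0 r =>
      rw [AlgHom.commutes, AlgHom.commutes, Matrix.algebraMap_matrix_apply,
        Matrix.algebraMap_matrix_apply]
      simp
    | grade1 q =>
      obtain ⟨⟨x, y⟩, hq⟩ := q
      have hxy : x ≠ y := hq
      have hv : (x : ℕ) ≠ y := fun h => hxy (Fin.ext h)
      simp [emb, leftCoeff, a, hxy, hv]
    | mul x y hx hy => simp [Matrix.mul_apply, hx, hy]
    | add x y hx hy => simp [hx, hy]
  have h2 : leftCoeff j (a k.castSucc (Fin.last n)) = if k = j then !![0, 1; 0, 0] else 0 := by
    have h : k.castSucc ≠ Fin.last n := (Fin.castSucc_lt_last k).ne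
    simp [leftCoeff, a, h, Fin.val_inj]
  rw [map_mul, h2, Matrix.mul_apply]
  split_ifs <;> simp [h1]

/-- The analogue of `leftCoeff` for the right coefficient of `a_{n+1,j}`. -/
noncomputable def rightCoeff {n : ℕ} (j : Fin n) : A (n + 1) →ₐ[ℤ] Matrix (Fin 2) (Fin 2) (A n) :=
  FreeAlgebra.lift ℤ fun q =>
    if h : (q.1.2 : ℕ) < n then
      if k : (q.1.1 : ℕ) < n then !![0, 0; 0, a ⟨q.1.1, k⟩ ⟨q.1.2, h⟩]
      else if (q.1.2 : ℕ) = j then !![0, 1; 0, 0] else 0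
    else 0

theorem rightCoeff_mul {n : ℕ} (j k : Fin n) (u : A n) :
    rightCoeff j (a (Fin.last n) k.castSucc * emb n u) 0 1 = if k = j then u else 0 := by
  have h1 : rightCoeff j (emb n u) 1 1 = u ∧ rightCoeff j (emb n u) 0 1 = 0 := by
    induction u using FreeAlgebra.induction with
    | grade0 r =>
      rw [AlgHom.commutes, AlgHom.commutes, Matrix.algebraMap_matrix_apply,
        Matrix.algebraMap_matrix_apply]
      simp
    | grade1 q =>
      obtain ⟨⟨x, y⟩, hq⟩ := q
      have hxy : x ≠ y := hq
      have hv : (x : ℕ) ≠ y := fun h => hxy (Fin.ext h)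
      simp [emb, rightCoeff, a, hxy, hv]
    | mul x y hx hy => simp [Matrix.mul_apply, hx, hy]
    | add x y hx hy => simp [hx, hy]
  have h2 : rightCoeff j (a (Fin.last n) k.castSucc) = if k = j then !![0, 1; 0, 0] else 0 := by
    have h : Fin.last n ≠ k.castSucc := (Fin.castSucc_lt_last k).ne'
    simp [rightCoeff, a, h, Fin.val_inj]
  rw [map_mul, h2, Matrix.mul_apply]
  split_ifs <;> simp [h1]

/-- Left coefficients are unique, because `𝒜_{n+1}` is free. -/
theorem IsLeftMatrix.unique {n : ℕ} {f : A (n + 1) → A (n + 1)}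
    {M N : Matrix (Fin n) (Fin n) (A n)} (hM : IsLeftMatrix f M) (hN : IsLeftMatrix f N) :
    M = N := by
  funext i j
  have hi := (hM i).symm.trans (hN i)
  have h := congrArg (fun u => leftCoeff j u 0 1) hi
  simp only [map_sum, Matrix.sum_apply, leftCoeff_mul] at h
  simpa using h

/-- Right coefficients are unique, because `𝒜_{n+1}` is free. -/
theorem IsRightMatrix.unique {n : ℕ} {f : A (n + 1) → A (n + 1)}
    {M N : Matrix (Fin n) (Fin n) (A n)} (hM : IsRightMatrix f M) (hN : IsRightMatrix f N) :
    M = N := by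
  funext i j
  have hj := (hM j).symm.trans (hN j)
  have h := congrArg (fun u => rightCoeff i u 0 1) hj
  simp only [map_sum, Matrix.sum_apply, rightCoeff_mul] at h
  simpa using h

/-- The matrix `Φ^L_β`, defined by `φ*_β(a_{i,n+1}) = ∑_j (Φ^L_β)_{ij} a_{j,n+1}`. -/
noncomputable def PhiL {n : ℕ} (β : BraidGroup n) : Matrix (Fin n) (Fin n) (A n) :=
  (exists_left β).choose

theorem PhiL_spec {n : ℕ} (β : BraidGroup n) : IsLeftMatrix (phiStar β) (PhiL β) :=
  (exists_left β).choose_spec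

/-- The matrix `Φ^R_β`, defined by `φ*_β(a_{n+1,i}) = ∑_j a_{n+1,j} (Φ^R_β)_{ji}`. -/
noncomputable def PhiR {n : ℕ} (β : BraidGroup n) : Matrix (Fin n) (Fin n) (A n) :=
  (exists_right β).choose

theorem PhiR_spec {n : ℕ} (β : BraidGroup n) : IsRightMatrix (phiStar β) (PhiR β) :=
  (exists_right β).choose_spec

/-! ### Augmentations and their rank -/

/-- `R_0 = ℤ[λ^{±1}, μ^{±1}]`. -/
abbrev R0 : Type := LaurentPolynomial (LaurentPolynomial ℤ)

/-- `λ^k μ^m ∈ R_0`. -/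
noncomputable def lamMu (k m : ℤ) : R0 :=
  LaurentPolynomial.C (LaurentPolynomial.T m) * LaurentPolynomial.T k

/-- `𝒜_n ⊗ R_0` (over `ℤ`; the module structures are those of the two `ℤ`-algebras). -/
abbrev AR (n : ℕ) : Type :=
  @TensorProduct ℤ _ (A n) R0 _ _ Algebra.toModule Algebra.toModule

/-- `x ↦ x ⊗ 1`. -/
noncomputable def inA (n : ℕ) : A n →+* AR n :=
  (Algebra.TensorProduct.includeLeft : A n →ₐ[ℤ] AR n).toRingHom

/-- `x ↦ 1 ⊗ x`. -/
noncomputable def inR (n : ℕ) : R0 →+* AR n :=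
  (Algebra.TensorProduct.includeRight : R0 →ₐ[ℤ] AR n).toRingHom

/-- The matrix `𝐀` over `𝒜_n ⊗ R_0`. -/
noncomputable def matA (n : ℕ) : Matrix (Fin n) (Fin n) (AR n) := fun i j =>
  if i < j then inA n (a i j)
  else if j < i then -(inR n (lamMu 0 1) * inA n (a i j))
  else inR n (1 - lamMu 0 1)

/-- `Λ = diag(λ μ^{ω(β)}, 1, …, 1)`. -/
noncomputable def matLam {n : ℕ} (β : BraidGroup n) : Matrix (Fin n) (Fin n) (AR n) :=
  Matrix.diagonal fun i => if (i : ℕ) = 0 then inR n (lamMu 1 (BraidGroup.writhe β)) else 1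

/-- `Λ⁻¹ = diag(λ⁻¹ μ^{-ω(β)}, 1, …, 1)`. -/
noncomputable def matLamInv {n : ℕ} (β : BraidGroup n) : Matrix (Fin n) (Fin n) (AR n) :=
  Matrix.diagonal fun i =>
    if (i : ℕ) = 0 then inR n (lamMu (-1) (-BraidGroup.writhe β)) else 1

/-- The two-sided ideal `ℐ` of `𝒜_n ⊗ R_0` generated by the entries of `𝐀 - Λ Φ^L_β 𝐀` and of
`𝐀 - 𝐀 Φ^R_β Λ⁻¹`. The quotient by it is the degree zero knot contact homology of the closure
of `β`. -/
noncomputable def kchIdeal {n : ℕ} (β : BraidGroup n) : TwoSidedIdeal (AR n) :=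
  TwoSidedIdeal.span
    ({x | ∃ i j, x = (matA n - matLam β * (PhiL β).map (inA n) * matA n) i j} ∪
     {x | ∃ i j, x = (matA n - matA n * (PhiR β).map (inA n) * matLamInv β) i j})

/-- An augmentation of the closure of `β`: a ring homomorphism `𝒜_n ⊗ R_0 → ℂ` that vanishes
on `ℐ`. -/
def IsAugmentation {n : ℕ} (β : BraidGroup n) (ε : AR n →+* ℂ) : Prop :=
  ∀ x ∈ kchIdeal β, ε x = 0

/-- The rank of `ε(𝐀)`. -/
noncomputable def augRank {n : ℕ} (ε : AR n →+* ℂ) : ℕ := ((matA n).map ε).rank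

/-- The ranks of the augmentations `ε` of the closure of `β` with `ε(μ) ≠ 1`. -/
def augRanks {n : ℕ} (β : BraidGroup n) : Set ℕ :=
  {r | ∃ ε : AR n →+* ℂ, IsAugmentation β ε ∧ ε (inR n (lamMu 0 1)) ≠ 1 ∧ augRank ε = r}

/-- The augmentation rank `ar(K)` of the closure `K` of `β`: the maximal rank of an augmentation
(the supremum is over a set bounded by `n`). -/
noncomputable def ar {n : ℕ} (β : BraidGroup n) : ℕ := sSup (augRanks β)

theorem augRanks_bddAbove {n : ℕ} (β : BraidGroup n) : BddAbove (augRanks β) := by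
  refine ⟨n, ?_⟩
  rintro r ⟨ε, -, -, rfl⟩
  simpa [augRank] using ((matA n).map ε).rank_le_card_width

/-- `Δ(β) = diag((-1)^{ω(β)}, 1, …, 1)` over `ℂ`. -/
noncomputable def matDelta {n : ℕ} (β : BraidGroup n) : Matrix (Fin n) (Fin n) ℂ :=
  Matrix.diagonal fun i => if (i : ℕ) = 0 then (-1 : ℂ) ^ BraidGroup.writhe β else 1

end CordAlgebra

/-! A homomorphism ε : 𝒜_N → ℂ is realized by reflections s_j whose roots are basis vectors e_j,
with s_j(e_i) = e_i - ε(a_{ij}) e_j. Braids act on such tuples by Hurwitz moves, and the new roots,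
expressed in the old ones, have the rows of ε(Φ^L_β) as coefficients (`moves_sigma`, `Moves.mul`).
For an augmentation of full rank ε(𝐀) is invertible, so ε(Φ^L_β) = ε(Λ)⁻¹ is diagonal with all
entries but the first equal to 1; Δ(β) has the same shape. Both claims therefore reduce to excluding
this shape (`PhiL_satellite_torus_ne_diagonal`).

Group the np roots into n blocks of length p. Let V_b be the span of the block b, x_b the product of
its reflections and L = x_0 ⋯ x_{n-1}. The p-parallel of α is the (n+1)-st power of the rotation in
which the leading block crosses all others. It turns the roots e of block b + 1 into the roots L x_0
x_{b+1}⁻¹ e in block b, and the roots e of block 0 into the roots L x_0⁻¹ e in block n - 1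
(`moves_rotate_pow`).

Since γ touches only block 0, a diagonal matrix of the excluded shape forces L V_0 ⊆ V_{n-1} and L
x_0 V_{b+1} ⊆ V_b (`BlockCycle`). Each x_b changes only coordinates in block b, so these inclusions
can be evaluated one factor of L at a time. The outcome is that the parallel of α makes the first
root of block 0 equal to (-1)^{n-1} e_0 (`BlockCycle.return_eq`). But γ carries this root unchanged
to position p - 1, where the diagonal entry 1 demands e_{p-1}. For p > 1 this is a contradiction. -/

namespace CordAlgebra

/-! ### Tuples of reflections and the Hurwitz action -/

/-- The invertible linear operators of the space of complex sequences. -/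
abbrev Op : Type := (ℕ → ℂ) ≃ₗ[ℂ] (ℕ → ℂ)

/-- The action of an operator on a pair of a (pseudo-)reflection and its root. -/
def conjPair (x : Op) (t : Op × (ℕ → ℂ)) : Op × (ℕ → ℂ) := (x * t.1 * x⁻¹, x t.2)

theorem conjPair_mul (x y : Op) (t : Op × (ℕ → ℂ)) :
    conjPair (x * y) t = conjPair x (conjPair y t) := by
  simp [conjPair, mul_assoc]

theorem conjPair_one (t : Op × (ℕ → ℂ)) : conjPair 1 t = t := by
  simp [conjPair]

/-- The tuple of reflections and roots `t` has the numbers `ε(a_{ij})` as structure constants. -/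
def Realizes {N : ℕ} (ε : A N →+* ℂ) (t : ℕ → Op × (ℕ → ℂ)) : Prop :=
  (∀ j : Fin N, (t j).1 (t j).2 = -(t j).2) ∧
  ∀ i j : Fin N, i ≠ j → (t j).1 (t i).2 = (t i).2 - ε (a i j) • (t j).2

/-- The braid `β` carries the tuple `t` to the tuple `t'`. -/
def Moves {N : ℕ} (β : BraidGroup N) (t t' : ℕ → Op × (ℕ → ℂ)) : Prop :=
  ∀ ε : A N →+* ℂ, Realizes ε t →
    Realizes (ε.comp (phi N β : A N →+* A N)) t' ∧
    ∀ i : Fin N, (t' i).2 = ∑ j : Fin N, ε (PhiL β i j) • (t j).2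

theorem PhiL_one {N : ℕ} : PhiL (1 : BraidGroup N) = 1 :=
  (PhiL_spec _).unique fun i => by simp [phiStar, Matrix.one_apply, apply_ite (emb N)]

theorem PhiL_mul {N : ℕ} (β γ : BraidGroup N) :
    PhiL (β * γ) = (PhiL γ).map (phi N β) * PhiL β :=
  (PhiL_spec _).unique ((PhiL_spec β).mul (PhiL_spec γ))

theorem PhiL_sigma {N : ℕ} (k : Fin (N - 1)) :
    PhiL (BraidGroup.sigma k) = fun i j =>
      if i = hi k then (if j = lo k then 1 else 0) else if i = lo k then
      ((if j = hi k then 1 else 0) - (if j = lo k then a (hi k) (lo k) else 0))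
      else if j = i then 1 else 0 := by
  refine (PhiL_spec _).unique fun i => ?_
  have h := lo_ne_hi k
  have hi' : i.castSucc ≠ Fin.last N := (Fin.castSucc_lt_last i).ne
  have hy : Fin.last N ≠ (hi k).castSucc := (Fin.castSucc_lt_last _).ne'
  have hx : Fin.last N ≠ (lo k).castSucc := (Fin.castSucc_lt_last _).ne'
  rw [phiStar_sigma, phiHom_a _ _ hi']
  by_cases h1 : i = hi k
  · subst h1
    simp [phiGen, hx, hy, h.symm, apply_ite (emb N), ite_mul]
  · by_cases h2 : i = lo k
    · subst h2
      simp [phiGen, hx, hy, h, apply_ite (emb N), ite_mul, sub_mul, emb_a, Finset.sum_sub_distrib]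
    · simp [phiGen, hx, hy, h1, h2, apply_ite (emb N), ite_mul]

theorem Moves.one {N : ℕ} (t : ℕ → Op × (ℕ → ℂ)) : Moves (1 : BraidGroup N) t t := by
  intro ε h
  refine ⟨?_, fun i => ?_⟩
  · convert h
    ext u
    simp
  · simp [PhiL_one, Matrix.one_apply, apply_ite ε, ite_smul]

/-- This is the chain rule Φ^L_{βγ} = φ_β(Φ^L_γ) Φ^L_β. It composes because `Moves` quantifies over
every ε: the second move is used at ε ∘ φ_β. -/
theorem Moves.mul {N : ℕ} {β γ : BraidGroup N} {t t' t'' : ℕ → Op × (ℕ → ℂ)}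
    (h : Moves β t t') (h' : Moves γ t' t'') : Moves (β * γ) t t'' := by
  intro ε hε
  obtain ⟨h1, h2⟩ := h ε hε
  obtain ⟨h3, h4⟩ := h' _ h1
  refine ⟨?_, fun i => ?_⟩
  · convert h3 using 1
    ext u
    simp
  · rw [h4 i, PhiL_mul]
    simp only [h2, Matrix.mul_apply, Matrix.map_apply, map_sum, map_mul, Finset.smul_sum,
      Finset.sum_smul, smul_smul]
    exact Finset.sum_comm

theorem Moves.congr {N : ℕ} {β : BraidGroup N} {t t' t'' : ℕ → Op × (ℕ → ℂ)}
    (h : Moves β t t') (h' : ∀ j < N, t' j = t'' j) : Moves β t t'' := by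
  intro ε hε
  obtain ⟨h1, h2⟩ := h ε hε
  refine ⟨⟨fun j => ?_, fun i j hij => ?_⟩, fun i => ?_⟩
  · rw [← h' j j.2]; exact h1.1 j
  · rw [← h' j j.2, ← h' i i.2]; exact h1.2 i j hij
  · rw [← h' i i.2]; exact h2 i

/-- The Hurwitz move of the positions `k` and `k + 1`. -/
def hurwitz (k : ℕ) (t : ℕ → Op × (ℕ → ℂ)) (j : ℕ) : Op × (ℕ → ℂ) :=
  if j = k then conjPair (t k).1 (t (k + 1)) else if j = k + 1 then t k else t j

theorem Realizes.inv_apply {N : ℕ} {ε : A N →+* ℂ} {t : ℕ → Op × (ℕ → ℂ)} (h : Realizes ε t)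
    {i j : Fin N} (hij : i ≠ j) : (t j).1⁻¹ (t i).2 = (t i).2 - ε (a i j) • (t j).2 := by
  have : (t j).1 ((t i).2 - ε (a i j) • (t j).2) = (t i).2 := by
    rw [map_sub, map_smul, h.1, h.2 i j hij]; simp
  conv_lhs => rw [← this]
  rw [← LinearEquiv.mul_apply]; simp

theorem Realizes.inv_apply_self {N : ℕ} {ε : A N →+* ℂ} {t : ℕ → Op × (ℕ → ℂ)}
    (h : Realizes ε t) (j : Fin N) : (t j).1⁻¹ (t j).2 = -(t j).2 := by
  have : (t j).1 (-(t j).2) = (t j).2 := by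
    rw [map_neg, h.1]; simp
  conv_lhs => rw [← this]
  rw [← LinearEquiv.mul_apply]; simp

/-- The formulas for φ_{σ_k} are exactly the change of structure constants when the pair (s_k,
s_{k+1}) is replaced by (s_k s_{k+1} s_k⁻¹, s_k). The case analysis follows the positions of i and j
relative to k and k + 1. -/
theorem moves_sigma {N : ℕ} (k : Fin (N - 1)) (t : ℕ → Op × (ℕ → ℂ)) :
    Moves (BraidGroup.sigma k) t (hurwitz k t) := by
  intro ε h
  have hl : ((lo k : Fin N) : ℕ) = k := rfl
  have hh : ((hi k : Fin N) : ℕ) = k + 1 := rfl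
  have hne := lo_ne_hi k
  have e1 : hurwitz k t (lo k : Fin N) = conjPair (t (lo k : Fin N)).1 (t (hi k : Fin N)) := by
    simp [hurwitz, hl, hh]
  have e2 : hurwitz k t (hi k : Fin N) = t (lo k : Fin N) := by simp [hurwitz, hl, hh]
  have e3 : ∀ i : Fin N, i ≠ lo k → i ≠ hi k → hurwitz k t i = t i := fun i h1 h2 => by
    have h1' : (i : ℕ) ≠ k := fun h => h1 (Fin.ext h)
    have h2' : (i : ℕ) ≠ k + 1 := fun h => h2 (Fin.ext h)
    simp [hurwitz, h1', h2']
  have hφ : ∀ i j : Fin N, i ≠ j →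
      (ε.comp (phi N (BraidGroup.sigma k) : A N →+* A N)) (a i j) =
        ε (phiGen (lo k) (hi k) i j) := fun i j hij => by
    simp [phi_sigma, phiHom_a _ _ hij]
  have hP : ∀ i j, PhiL (BraidGroup.sigma k) i j = _ := fun i j => by rw [PhiL_sigma]
  generalize lo k = x at *
  generalize hi k = y at *
  clear hl hh
  have hne' := hne.symm
  refine ⟨⟨fun j => ?_, fun i j hij => ?_⟩, fun i => ?_⟩
  · by_cases hx : j = x
    · subst hx
      rw [e1]; simp [conjPair, h.1]
    by_cases hy : j = y
    · subst hy
      rw [e2]; exact h.1 _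
    rw [e3 j hx hy]; exact h.1 j
  · rw [hφ i j hij]
    have hji := hij.symm
    by_cases ix : i = x
    · subst ix
      by_cases jy : j = y
      · subst jy
        rw [e1, e2]
        simp [conjPair, phiGen, h.2 _ _ hne', h.1]
      · rw [e1, e3 j hji jy]
        simp only [conjPair, phiGen, jy, hji, hne, if_false, and_false, if_true,
          map_sub, map_mul]
        rw [h.2 _ _ hne', map_sub, map_smul, h.2 _ _ hij, h.2 _ _ (Ne.symm jy)]
        module
    by_cases iy : i = y
    · subst iy
      by_cases jx : j = x
      · subst jx
        rw [e1, e2]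
        simp [conjPair, phiGen, hne', h.inv_apply_self, h.2 _ _ hne, h.1, add_comm]
      · rw [e2, e3 j jx hji, h.2 _ _ (Ne.symm jx)]
        simp [phiGen, jx, hne']
    by_cases jx : j = x
    · subst jx
      rw [e1, e3 i ix iy]
      simp only [conjPair, phiGen, ix, iy, hne, if_false, false_and, and_false, if_true,
        map_sub, map_mul, LinearEquiv.mul_apply, h.inv_apply ix, h.2 _ _ iy, h.2 _ _ hne,
        h.2 _ _ ix, map_smul, h.1]
      module
    by_cases jy : j = y
    · subst jy
      rw [e2, e3 i ix iy, h.2 _ _ ix]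
      simp [phiGen, ix, iy, hne']
    · rw [e3 i ix iy, e3 j jx jy, h.2 _ _ hij]
      simp [phiGen, ix, iy, jx, jy]
  · simp only [hP]
    by_cases iy : i = y
    · subst iy
      simp [e2, apply_ite ε, ite_smul]
    by_cases ix : i = x
    · subst ix
      simp [e1, apply_ite ε, ite_smul, conjPair, h.2 _ _ hne', hne, sub_smul,
        Finset.sum_sub_distrib]
    · simp [e3 i ix iy, ix, iy, apply_ite ε, ite_smul]

/-! ### Hurwitz moves of strands and blocks -/

open BraidGroup

theorem moves_sigmaNat {N k : ℕ} (hk : k + 1 < N) (t : ℕ → Op × (ℕ → ℂ)) :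
    Moves (sigmaNat N k) t (hurwitz k t) := by
  rw [BraidGroup.sigmaNat, dif_pos (by omega)]
  exact moves_sigma ⟨k, by omega⟩ t

theorem moves_strandCross {N a l : ℕ} (h : a + l < N) (t : ℕ → Op × (ℕ → ℂ)) :
    Moves (strandCross (sigmaNat N) a l) t fun j =>
      if a ≤ j ∧ j < a + l then conjPair (t a).1 (t (j + 1))
      else if j = a + l then t a else t j := by
  induction l with
  | zero =>
    refine (Moves.one t).congr fun j _ => ?_
    split_ifs with h1 h2
    · omega
    · simp [h2]
    · rfl
  | succ l ih =>
    refine ((ih (by omega)).mul (moves_sigmaNat (by omega) _)).congr fun j _ => ?_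
    by_cases h1 : j = a + l
    · subst h1; simp [hurwitz]
    by_cases h2 : j = a + l + 1
    · subst h2; simp [hurwitz, add_assoc]
    by_cases h3 : a ≤ j ∧ j < a + l
    · simp [hurwitz, h1, h2, h3, show j < a + (l + 1) by omega]
    · simp [hurwitz, h1, h2, h3, show ¬ (a ≤ j ∧ j < a + (l + 1)) by omega,
        show j ≠ a + (l + 1) by omega]

/-- The product of the operators in the positions `a, …, a + m - 1`. -/
def blockProd (t : ℕ → Op × (ℕ → ℂ)) (a : ℕ) : ℕ → Op
  | 0 => 1
  | m + 1 => blockProd t a m * (t (a + m)).1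

theorem blockProd_congr {t t' : ℕ → Op × (ℕ → ℂ)} {a a' m : ℕ}
    (h : ∀ j < m, (t (a + j)).1 = (t' (a' + j)).1) : blockProd t a m = blockProd t' a' m := by
  induction m with
  | zero => rfl
  | succ m ih => rw [blockProd, blockProd, ih fun j hj => h j (by omega), h m (by omega)]

theorem blockProd_conj {t t' : ℕ → Op × (ℕ → ℂ)} {a a' m : ℕ} (x : Op)
    (h : ∀ j < m, t (a + j) = conjPair x (t' (a' + j))) :
    blockProd t a m = x * blockProd t' a' m * x⁻¹ := by
  induction m with
  | zero => simp [blockProd]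
  | succ m ih =>
    rw [blockProd, blockProd, ih fun j hj => h j (by omega), h m (by omega)]
    simp [conjPair, mul_assoc]

/-- The lowest of the m strands goes first and conjugates the l strands by its operator. The other m
strands are unaffected by this and conjugate further, so the accumulated operator is the ordered
product over the block. -/
theorem moves_blockCross {N a m l : ℕ} (h : a + m + l ≤ N) (t : ℕ → Op × (ℕ → ℂ)) :
    Moves (blockCross (sigmaNat N) a m l) t fun j =>
      if a ≤ j ∧ j < a + l then conjPair (blockProd t a m) (t (j + m))
      else if a + l ≤ j ∧ j < a + l + m then t (j - l) else t j := by
  induction m generalizing t with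
  | zero =>
    refine (Moves.one t).congr fun j _ => ?_
    split_ifs with h1 h2
    · simp [blockProd, conjPair_one]
    · omega
    · rfl
  | succ m ih =>
    refine ((moves_strandCross (by omega) t).mul (ih (by omega) _)).congr fun j _ => ?_
    by_cases h1 : a ≤ j ∧ j < a + l
    · rw [if_pos h1, if_pos h1, if_pos (by omega), blockProd, conjPair_mul, ← add_assoc]
      congr 1
      refine blockProd_congr fun i hi => ?_
      rw [if_neg (by omega), if_neg (by omega)]
    rw [if_neg h1, if_neg h1]
    by_cases h2 : a + l ≤ j ∧ j < a + l + m
    · rw [if_pos h2, if_neg (show ¬ (a + m ≤ j - l ∧ j - l < a + m + l) by omega),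
        if_neg (show ¬ j - l = a + m + l by omega),
        if_pos (show a + l ≤ j ∧ j < a + l + (m + 1) by omega)]
    rw [if_neg h2, if_neg (by omega)]
    by_cases h3 : j = a + m + l
    · rw [if_pos h3, if_pos (by omega)]
      congr 1; omega
    · rw [if_neg h3, if_neg (by omega)]

/-! ### The satellite braid as a power of a rotation of blocks -/

theorem prod_ofFn_blockCross {G : Type*} [Group G] {s : ℕ → G}
    (hc : ∀ i j, i + 2 ≤ j → s i * s j = s j * s i) (p l : ℕ) :
    (List.ofFn fun i : Fin l => BraidGroup.blockCross s (i * p) p p).prod =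
      BraidGroup.blockCross s 0 p (l * p) := by
  induction l with
  | zero =>
    have : ∀ m a, BraidGroup.blockCross s a m 0 = 1 := fun m a => by
      induction m with
      | zero => rfl
      | succ m ih => simp [BraidGroup.blockCross, BraidGroup.strandCross, ih]
    simp [this]
  | succ l ih =>
    rw [List.ofFn_succ', List.concat_eq_append, List.prod_append, Nat.succ_mul, blockCross_add hc]
    simp [ih]

theorem prod_ofFn_eq_strandCross {G : Type*} [Group G] (s : ℕ → G) (l : ℕ) :
    (List.ofFn fun i : Fin l => s i).prod = BraidGroup.strandCross s 0 l := by
  induction l with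
  | zero => rfl
  | succ l ih =>
    rw [List.ofFn_succ', List.concat_eq_append, List.prod_append, BraidGroup.strandCross]
    simp [ih]

/-- The parallel of σ_1 ⋯ σ_{n-1} is a single crossing of the first block with the n - 1 others, and
γ is the crossing of the first strand with the p - 1 below it. -/
theorem satellite_torus {n p : ℕ} (hn : 0 < n) :
    satellite hn (torus n (n + 1)) (torus p 1) =
      BraidGroup.blockCross (sigmaNat (n * p)) 0 p ((n - 1) * p) ^ (n + 1) *
        BraidGroup.strandCross (sigmaNat (n * p)) 0 (p - 1) := by
  have hle : p ≤ n * p := Nat.le_mul_of_pos_left p hn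
  rw [satellite, torus, torus, zpow_one, map_zpow, map_list_prod, map_list_prod, List.map_ofFn,
    List.map_ofFn, ← prod_ofFn_blockCross (sigmaNat_comm _), ← prod_ofFn_eq_strandCross]
  congr 1
  · rw [← zpow_natCast]
    simp [Function.comp_def, parallel]
  · congr 1
    congr 1
    funext i
    simp only [Function.comp_def, incl, lift_sigma, sigmaNat]
    rw [dif_pos (by omega)]
    rfl

/-- The tuple that consists of blocks of length `p`. -/
def flatten (p : ℕ) (T : ℕ → ℕ → Op × (ℕ → ℂ)) (j : ℕ) : Op × (ℕ → ℂ) := T (j / p) (j % p)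

theorem flatten_apply {p : ℕ} (T : ℕ → ℕ → Op × (ℕ → ℂ)) (b : ℕ) {i : ℕ} (hi : i < p) :
    flatten p T (b * p + i) = T b i := by
  have hp : 0 < p := by omega
  rw [flatten, mul_comm, Nat.mul_add_div hp, Nat.div_eq_of_lt hi, Nat.mul_add_mod,
    Nat.mod_eq_of_lt hi, add_zero]

/-- One block crosses all the others. -/
theorem moves_rotate {n p : ℕ} (hn : 0 < n) (hp : 0 < p) (T : ℕ → ℕ → Op × (ℕ → ℂ)) :
    Moves (BraidGroup.blockCross (sigmaNat (n * p)) 0 p ((n - 1) * p)) (flatten p T)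
      (flatten p fun b i => if b + 1 < n then conjPair (blockProd (T 0) 0 p) (T (b + 1) i)
        else T 0 i) := by
  obtain ⟨m, rfl⟩ : ∃ m, n = m + 1 := ⟨n - 1, by omega⟩
  have hmp : (m + 1) * p = m * p + p := by ring
  refine (moves_blockCross (by simp only [Nat.add_sub_cancel]; omega) _).congr fun j hj => ?_
  simp only [Nat.add_sub_cancel, zero_add, zero_le, true_and]
  obtain ⟨b, i, hi, rfl⟩ : ∃ b i, i < p ∧ j = b * p + i :=
    ⟨j / p, j % p, Nat.mod_lt _ hp, by rw [mul_comm]; exact (Nat.div_add_mod j p).symm⟩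
  simp only [flatten_apply _ _ hi]
  by_cases hb : b < m
  · have : (b + 1) * p ≤ m * p := Nat.mul_le_mul_right p hb
    have hbp : (b + 1) * p = b * p + p := by ring
    rw [if_pos (by omega), if_pos (by omega), show b * p + i + p = (b + 1) * p + i by omega,
      flatten_apply _ _ hi]
    congr 1
    refine blockProd_congr fun j hj => ?_
    rw [zero_add, ← flatten_apply T 0 hj]; simp
  · have : m * p ≤ b * p := Nat.mul_le_mul_right p (not_lt.1 hb)
    have hbm : b = m := by
      have h2 : b * p < (m + 1) * p := by omega
      have := Nat.lt_of_mul_lt_mul_right h2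
      omega
    subst hbm
    rw [if_neg (show ¬ b * p + i < b * p by omega),
      if_pos (show b * p ≤ b * p + i ∧ b * p + i < b * p + p by omega),
      if_neg (lt_irrefl _), Nat.add_sub_cancel_left,
      ← flatten_apply T 0 hi]
    simp

/-- The product `x_0 x_1 ⋯ x_{k-1}`. -/
def leadProd {G : Type*} [Group G] (x : ℕ → G) : ℕ → G
  | 0 => 1
  | k + 1 => leadProd x k * x k

/-- The blocks move along the sequence `S`, in which the block `k + n` is the block `k` acted upon
by the inverse of its product. -/
theorem moves_rotate_pow {n p : ℕ} (hn : 0 < n) (hp : 0 < p) {S : ℕ → ℕ → Op × (ℕ → ℂ)}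
    {x : ℕ → Op} (hx : ∀ k, blockProd (S k) 0 p = x k)
    (hS : ∀ k i, S (k + n) i = conjPair (x k)⁻¹ (S k i)) (k : ℕ) :
    Moves (BraidGroup.blockCross (sigmaNat (n * p)) 0 p ((n - 1) * p) ^ k) (flatten p S)
      (flatten p fun b i => conjPair (leadProd x k) (S (k + b) i)) := by
  induction k with
  | zero => simpa [leadProd, conjPair_one] using Moves.one (flatten p S)
  | succ k ih =>
    rw [pow_succ]
    refine (ih.mul (moves_rotate hn hp _)).congr fun j hj => ?_
    have hb : j / p < n := Nat.div_lt_of_lt_mul (by rwa [mul_comm])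
    simp only [flatten]
    -- With g the leading product of length k, the leading block is g · S k and has product g x_k
    -- g⁻¹. Crossing it turns the prefix g of the other blocks into g x_k.
    rw [blockProd_conj (a' := 0) (t' := S k) (leadProd x k) fun j _ => by simp, hx, leadProd]
    split_ifs with h
    · rw [← conjPair_mul, show k + (j / p + 1) = k + 1 + j / p by ring]
      simp [mul_assoc]
    -- The block that crossed keeps its value g · S k, which equals (g x_k) · S (k + n) by the rule
    -- for `S`.
    · rw [show k + 1 + j / p = k + n by omega, hS, ← conjPair_mul]
      simp

/-- Every finite tuple of blocks extends to a sequence as in `moves_rotate_pow`. -/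
theorem exists_extension {n p : ℕ} (hn : 0 < n) (T : ℕ → ℕ → Op × (ℕ → ℂ)) :
    ∃ S : ℕ → ℕ → Op × (ℕ → ℂ), (∀ b < n, S b = T b) ∧
      (∀ k, blockProd (S k) 0 p = blockProd (T (k % n)) 0 p) ∧
      ∀ k i, S (k + n) i = conjPair (blockProd (T (k % n)) 0 p)⁻¹ (S k i) := by
  -- Each full turn applies the inverse of the block product once more. Conjugating by powers of the
  -- block product does not change that product, so it depends only on k modulo n.
  refine ⟨fun k i => conjPair ((blockProd (T (k % n)) 0 p)⁻¹ ^ (k / n)) (T (k % n) i),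
    fun b hb => ?_, fun k => ?_, fun k i => ?_⟩
  · funext i
    simp [Nat.div_eq_of_lt hb, Nat.mod_eq_of_lt hb, conjPair_one]
  · rw [blockProd_conj (a' := 0) (t' := T (k % n)) ((blockProd (T (k % n)) 0 p)⁻¹ ^ (k / n))
      fun j _ => by simp]
    rw [mul_inv_eq_iff_eq_mul]
    exact ((Commute.refl _).inv_left.pow_left _).eq
  · simp only [Nat.add_mod_right, Nat.add_div_right k hn]
    rw [← conjPair_mul, pow_succ']

/-! ### Linear algebra of block operators -/

/-- The vectors whose support lies in the block `b`, for blocks of length `p`. -/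
def blockSpace (p b : ℕ) : Submodule ℂ (ℕ → ℂ) where
  carrier := {w | ∀ j, j / p ≠ b → w j = 0}
  add_mem' hv hw j hj := by simp [hv j hj, hw j hj]
  zero_mem' _ _ := rfl
  smul_mem' c w hw j hj := by simp [hw j hj]

theorem single_mem_blockSpace {p b i : ℕ} (hi : i < p) :
    Pi.single (b * p + i) (1 : ℂ) ∈ blockSpace p b := by
  intro j hj
  refine Pi.single_eq_of_ne (fun h => hj ?_) _
  have hp : 0 < p := by omega
  rw [h, mul_comm, Nat.mul_add_div hp, Nat.div_eq_of_lt hi, add_zero]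

/-- To map a block into a submodule it suffices to map its basis vectors there. -/
theorem map_mem_of_single {p b : ℕ} (hp : 0 < p) (g : Op) (V : Submodule ℂ (ℕ → ℂ))
    (h : ∀ i < p, g (Pi.single (b * p + i) 1) ∈ V) {w : ℕ → ℂ} (hw : w ∈ blockSpace p b) :
    g w ∈ V := by
  have : w = ∑ i ∈ Finset.range p, w (b * p + i) • Pi.single (b * p + i) (1 : ℂ) := by
    funext j
    simp only [Finset.sum_apply, Pi.smul_apply, Pi.single_apply, smul_eq_mul, mul_ite, mul_one,
      mul_zero]
    by_cases hj : j / p = b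
    · have hjb : b * p + j % p = j := by rw [← hj, mul_comm]; exact Nat.div_add_mod j p
      rw [Finset.sum_eq_single (j % p), hjb, if_pos rfl]
      · intro i _ hne
        rw [if_neg]; omega
      · intro h
        exact absurd (Finset.mem_range.2 (Nat.mod_lt j hp)) h
    · rw [hw j hj, Finset.sum_eq_zero]
      intro i hi
      rw [if_neg]
      rintro rfl
      apply hj
      rw [mul_comm, Nat.mul_add_div hp, Nat.div_eq_of_lt (Finset.mem_range.1 hi), add_zero]
  rw [this, map_sum]
  refine Submodule.sum_mem _ fun i hi => ?_
  rw [map_smul]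
  exact V.smul_mem _ (h i (Finset.mem_range.1 hi))

/-- `x` only changes the coordinates in the block `b`. -/
def ChangesBlock (p b : ℕ) (x : Op) : Prop := ∀ w j, j / p ≠ b → x w j = w j

theorem ChangesBlock.inv {p b : ℕ} {x : Op} (h : ChangesBlock p b x) : ChangesBlock p b x⁻¹ := by
  intro w j hj
  rw [← h (x⁻¹ w) j hj, ← LinearEquiv.mul_apply]; simp

theorem ChangesBlock.apply_mem {p b : ℕ} {x : Op} (h : ChangesBlock p b x) {w : ℕ → ℂ}
    (hw : w ∈ blockSpace p b) : x w ∈ blockSpace p b := fun j hj => by rw [h w j hj, hw j hj]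

theorem ChangesBlock.sub_mem {p b : ℕ} {x : Op} (h : ChangesBlock p b x) (w : ℕ → ℂ) :
    w - x w ∈ blockSpace p b := fun j hj => by simp [h w j hj]

/-- A vector together with its images under `x_{n-1}`, `x_{n-2} x_{n-1}`, ⋯; every step changes
one block. -/
structure BlockChain (p n : ℕ) (x : ℕ → Op) (z : ℕ → ℕ → ℂ) : Prop where
  changes : ∀ b < n, ChangesBlock p b (x b)
  step : ∀ k < n, z k = x k (z (k + 1))

/-- Between z_b and z_a only the blocks a, …, b - 1 are altered, each once. So z_k agrees with z_0
in the blocks from k on and with z_n in the blocks before k. -/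
theorem BlockChain.apply_eq {p n : ℕ} {x : ℕ → Op} {z : ℕ → ℕ → ℂ} (h : BlockChain p n x z)
    {a b j : ℕ} (hab : a ≤ b) (hb : b ≤ n) (hj : j / p < a ∨ b ≤ j / p) : z a j = z b j := by
  induction b, hab using Nat.le_induction with
  | base => rfl
  | succ b hab ih =>
    rw [ih (by omega) (by omega), h.step b (by omega), h.changes b (by omega) _ _ (by omega)]

theorem BlockChain.eq_of_forall {p n : ℕ} {x : ℕ → Op} {z : ℕ → ℕ → ℂ} (h : BlockChain p n x z)
    {a b : ℕ} (hab : a ≤ b) (hb : b ≤ n) (hz : ∀ j, a ≤ j / p → j / p < b → z 0 j = z n j) :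
    z a = z b := by
  funext j
  by_cases hj : j / p < a ∨ b ≤ j / p
  · exact h.apply_eq hab hb hj
  · rw [← h.apply_eq (Nat.zero_le a) (by omega) (by omega), hz j (by omega) (by omega),
      ← h.apply_eq hb le_rfl (by omega)]

/-- A product of block operators that permutes the blocks in the way of the torus braid. -/
structure BlockCycle (p n : ℕ) (x : ℕ → Op) : Prop where
  changes : ∀ b < n, ChangesBlock p b (x b)
  first : ∀ w ∈ blockSpace p 0, leadProd x n w ∈ blockSpace p (n - 1)
  shift : ∀ b, b + 1 < n → ∀ w ∈ blockSpace p (b + 1),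
    leadProd x n (x 0 w) ∈ blockSpace p b

namespace BlockCycle

variable {p n : ℕ} {x : ℕ → Op}

theorem exists_chain (h : BlockCycle p n x) (y : ℕ → ℂ) :
    ∃ z, BlockChain p n x z ∧ z n = y ∧ z 0 = leadProd x n y := by
  -- Cancelling the first k factors of L leaves z_k = x_k ⋯ x_{n-1} y.
  refine ⟨fun k => (leadProd x k)⁻¹ (leadProd x n y), ⟨h.changes, fun k _ => ?_⟩, ?_, ?_⟩
  · simp only [leadProd, mul_inv_rev, ← LinearEquiv.mul_apply]
    simp [← mul_assoc]
  · simp [← LinearEquiv.mul_apply]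
  · simp [leadProd]

/-- Follow the chain from w to v = L w. Both vanish in the blocks strictly between 0 and n - 1, so
the middle factors act trivially: x_{n-1} takes w to w + v, and x_0 takes w + v to v. -/
theorem last_apply (h : BlockCycle p n x) (hn : 1 < n) {w : ℕ → ℂ} (hw : w ∈ blockSpace p 0) :
    x 0 (x (n - 1) w) = x (n - 1) w - w ∧ leadProd x n w = x (n - 1) w - w := by
  obtain ⟨z, hz, hzn, hz0⟩ := h.exists_chain w
  have hv := h.first w hw
  rw [← hz0] at hv
  have h1 : z 1 = z (n - 1) := hz.eq_of_forall (by omega) (by omega) fun j h1 h2 => by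
    rw [hv j (by omega), hzn, hw j (by omega)]
  have h2 : z (n - 1) = x (n - 1) w := by
    rw [hz.step _ (by omega), Nat.sub_add_cancel (by omega), hzn]
  have h3 : x (n - 1) w = w + z 0 := by
    funext j
    rw [Pi.add_apply]
    by_cases hj : j / p = n - 1
    · rw [hw j (by omega), zero_add, ← h2,
        hz.apply_eq (a := 0) (b := n - 1) (Nat.zero_le _) (by omega) (by omega)]
    · rw [h.changes _ (by omega) _ _ hj, hv j hj, add_zero]
  rw [← hz0, h3, add_sub_cancel_left, ← h3, ← h2, ← h1, ← hz.step 0 (by omega)]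
  exact ⟨rfl, rfl⟩

/-- Put u = w - x_0 w, a vector of block 0, and follow the chain from x_0 w = w - u to v = L x_0 w
in block b. Only the factors at b + 1, b and 0 can act nontrivially: x_{b+1} erases w and leaves -u.
For b > 0, x_b then adds v and x_0 removes -u; for b = 0 the last step is v = -x_0 u. -/
theorem apply_sub (h : BlockCycle p n x) {b : ℕ} (hb : b + 1 < n) {w : ℕ → ℂ}
    (hw : w ∈ blockSpace p (b + 1)) :
    x (b + 1) w = x (b + 1) (w - x 0 w) - (w - x 0 w) ∧
    (b = 0 → leadProd x n (x 0 w) = -x 0 (w - x 0 w)) ∧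
    (0 < b → x b (w - x 0 w) = w - x 0 w - leadProd x n (x 0 w) ∧
      x 0 (leadProd x n (x 0 w)) = leadProd x n (x 0 w) + x 0 (w - x 0 w)) := by
  obtain ⟨z, hz, hzn, hz0⟩ := h.exists_chain (x 0 w)
  have hv := h.shift b hb w hw
  rw [← hz0] at hv ⊢
  have hu := (h.changes 0 (by omega)).sub_mem w
  have hy : x 0 w = w - (w - x 0 w) := by abel
  generalize w - x 0 w = u at hu hy ⊢
  rw [hy] at hzn
  have hyj : ∀ j, j / p ≠ b + 1 → z n j = -u j := fun j hj => by
    rw [hzn, Pi.sub_apply, hw j hj, zero_sub]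
  have h1 : z (b + 2) = z n := hz.eq_of_forall (by omega) le_rfl fun j h1 h2 => by
    rw [hv j (by omega), hyj j (by omega), hu j (by omega), neg_zero]
  have h2 : z (b + 1) = -u := by
    funext j
    by_cases hj : j / p = b + 1
    · rw [← hz.apply_eq (Nat.zero_le _) (by omega) (by omega), hv j (by omega), Pi.neg_apply,
        hu j (by omega), neg_zero]
    · rw [hz.step _ hb, h1, h.changes _ hb _ _ hj, hyj j hj, Pi.neg_apply]
  have h3 : x (b + 1) (w - u) = -u := by rw [← hzn, ← h1, ← hz.step _ hb, h2]
  refine ⟨?_, ?_, fun h0 => ?_⟩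
  · rw [map_sub] at h3
    rw [sub_eq_iff_eq_add.1 h3]; abel
  · rintro rfl
    rw [hz.step 0 (by omega), h2, map_neg]
  · have h4 : z b = x b (-u) := by rw [hz.step b (by omega), h2]
    have h5 : z b = -u + z 0 := by
      funext j
      rw [Pi.add_apply, Pi.neg_apply]
      by_cases hj : j / p = b
      · rw [hu j (by omega), neg_zero, zero_add,
          ← hz.apply_eq (Nat.zero_le _) (by omega) (by omega)]
      · rw [h4, h.changes _ (by omega) _ _ hj, hv j hj, add_zero, Pi.neg_apply]
    have h6 : z 1 = z b := hz.eq_of_forall (by omega) (by omega) fun j h1 h2 => by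
      rw [hv j (by omega), hyj j (by omega), hu j (by omega), neg_zero]
    constructor
    · rw [← neg_inj, ← map_neg, ← h4, h5]; abel
    · have h7 : z 0 = x 0 (-u + z 0) := by rw [← h5, ← h6]; exact hz.step 0 (by omega)
      rw [map_add, map_neg] at h7
      rw [eq_neg_add_iff_add_eq] at h7
      rw [← h7, add_comm]

/-- Downward induction on b, starting from `last_apply`. For the step from b + 1 to b, the vector w
= x_{b+1} v - v with v = x_0⁻¹ u satisfies w - x_0 w = u by the induction hypothesis, so `apply_sub`
computes both x_b u and its image under x_0. -/
theorem block_apply (h : BlockCycle p n x) (k : ℕ) : ∀ b, b + k + 1 = n → 0 < b →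
    ∀ u ∈ blockSpace p 0, x 0 (x b u) = x b u - u := by
  induction k with
  | zero =>
    intro b hb h0 u hu
    obtain rfl : b = n - 1 := by omega
    exact (h.last_apply (by omega) hu).1
  | succ k ih =>
    intro b hb h0 u hu
    have hx0 := h.changes 0 (by omega)
    have hu' := hx0.inv.apply_mem hu
    have hS := ih (b + 1) (by omega) (by omega) _ hu'
    have hxu : x 0 ((x 0)⁻¹ u) = u := by simp
    set v := (x 0)⁻¹ u
    have hw : x (b + 1) v - v ∈ blockSpace p (b + 1) := by
      rw [← neg_sub]
      exact Submodule.neg_mem _ ((h.changes (b + 1) (by omega)).sub_mem v)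
    have hη : (x (b + 1) v - v) - x 0 (x (b + 1) v - v) = u := by
      rw [map_sub, hS, hxu]; abel
    obtain ⟨h1, h2⟩ := (h.apply_sub (by omega) hw).2.2 h0
    rw [hη] at h1 h2
    rw [h1, map_sub, h2]; abel

theorem sub_apply (h : BlockCycle p n x) {b : ℕ} (hb : b + 1 < n) {w : ℕ → ℂ}
    (hw : w ∈ blockSpace p (b + 1)) :
    x (b + 1) w - x 0 (x (b + 1) w) = x 0 (w - x 0 w) := by
  have hS := h.block_apply (n - 1 - (b + 1)) (b + 1) (by omega) (by omega) _
    ((h.changes 0 (by omega)).sub_mem w)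
  have h1 := (h.apply_sub hb hw).1
  generalize w - x 0 w = u at *
  rw [h1, map_sub, hS]; abel

/-- The return map of the first block is a sign. -/
theorem return_eq (h : BlockCycle p n x) (hn : 1 < n) {f : ℕ → ℕ → ℂ}
    (hf : ∀ b < n, f b ∈ blockSpace p b)
    (hlast : f (n - 1) = leadProd x n ((x 0)⁻¹ (f 0)))
    (hmid : ∀ b, 0 < b → b + 1 < n → f b = leadProd x n (x 0 ((x (b + 1))⁻¹ (f (b + 1))))) :
    leadProd x n (x 0 ((x 1)⁻¹ (f 1))) = (-1 : ℂ) ^ (n - 1) • f 0 := by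
  have hinv : ∀ b v, x b ((x b)⁻¹ v) = v := fun b v => by simp
  -- The defect f_b - x_0 f_b changes sign at each step from block b + 1 down to block b, and it
  -- equals f_0 in the last block.
  have key : ∀ k, ∀ b, 0 < b → b + k + 1 = n → f b - x 0 (f b) = (-1 : ℂ) ^ k • f 0 := by
    intro k
    induction k with
    | zero =>
      intro b h0 hb
      obtain rfl : b = n - 1 := by omega
      have hw := (h.changes 0 (by omega)).inv.apply_mem (hf 0 (by omega))
      obtain ⟨h1, h2⟩ := h.last_apply hn hw
      rw [hlast, h2, map_sub, h1, hinv]; simp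
    | succ k ih =>
      intro b h0 hb
      have hw := (h.changes (b + 1) (by omega)).inv.apply_mem (hf (b + 1) (by omega))
      have h1 := h.sub_apply (by omega) hw
      have h2 := ((h.apply_sub (by omega) hw).2.2 h0).2
      rw [← hmid b h0 (by omega)] at h2
      rw [hinv, ih (b + 1) (by omega) (by omega)] at h1
      rw [h2, ← h1, pow_succ]; simp
  have hw := (h.changes 1 (by omega)).inv.apply_mem (hf 1 (by omega))
  have h1 := h.sub_apply (b := 0) (by omega) hw
  have h2 := (h.apply_sub (b := 0) (by omega) hw).2.1 rfl
  rw [zero_add] at h1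
  rw [h2, ← h1, hinv, key (n - 2) 1 (by omega) (by omega), show n - 1 = n - 2 + 1 by omega,
    pow_succ]
  simp

end BlockCycle

/-! ### Reflections with prescribed structure constants -/

theorem ChangesBlock.one {p b : ℕ} : ChangesBlock p b 1 := fun _ _ _ => rfl

theorem ChangesBlock.mul {p b : ℕ} {x y : Op} (hx : ChangesBlock p b x)
    (hy : ChangesBlock p b y) : ChangesBlock p b (x * y) := fun w j hj => by
  rw [LinearEquiv.mul_apply, hx _ j hj, hy w j hj]

theorem ChangesBlock.blockProd {p b a m : ℕ} {t : ℕ → Op × (ℕ → ℂ)}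
    (h : ∀ j < m, ChangesBlock p b (t (a + j)).1) : ChangesBlock p b (blockProd t a m) := by
  induction m with
  | zero => exact ChangesBlock.one
  | succ m ih => exact (ih fun j hj => h j (by omega)).mul (h m (by omega))

/-- The coroot of the `j`-th reflection with structure constants `ε(a_{ij})`. -/
noncomputable def coroot {N : ℕ} (ε : A N →+* ℂ) (j : Fin N) : Module.Dual ℂ (ℕ → ℂ) :=
  (2 : ℂ) • LinearMap.proj (j : ℕ) + ∑ i : Fin N, ε (a i j) • LinearMap.proj (i : ℕ)

theorem coroot_single {N : ℕ} (ε : A N →+* ℂ) (i j : Fin N) :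
    coroot ε j (Pi.single (i : ℕ) 1) = (if i = j then 2 else 0) + ε (a i j) := by
  simp [coroot, Pi.single_apply, Fin.val_inj, eq_comm]

theorem coroot_self {N : ℕ} (ε : A N →+* ℂ) (j : Fin N) :
    coroot ε j (Pi.single (j : ℕ) 1) = 2 := by
  -- The sum in `coroot` includes the index j itself, harmlessly, because `a j j` is 0.
  simp [coroot_single, a]

/-- The tuple of reflections with structure constants `ε(a_{ij})` and roots the standard basis. -/
noncomputable def stdTuple {N : ℕ} (ε : A N →+* ℂ) (j : ℕ) : Op × (ℕ → ℂ) :=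
  if h : j < N then (Module.reflection (coroot_self ε ⟨j, h⟩), Pi.single j 1)
  else (1, Pi.single j 1)

theorem stdTuple_snd {N : ℕ} (ε : A N →+* ℂ) (j : ℕ) : (stdTuple ε j).2 = Pi.single j 1 := by
  unfold stdTuple; split_ifs <;> rfl

theorem stdTuple_fst {N : ℕ} (ε : A N →+* ℂ) (j : Fin N) (w : ℕ → ℂ) :
    (stdTuple ε j).1 w = w - coroot ε j w • Pi.single (j : ℕ) 1 := by
  simp [stdTuple, Module.reflection_apply]

theorem realizes_stdTuple {N : ℕ} (ε : A N →+* ℂ) : Realizes ε (stdTuple ε) := by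
  refine ⟨fun j => ?_, fun i j hij => ?_⟩
  · rw [stdTuple_fst, stdTuple_snd, coroot_self, two_smul]; abel
  · rw [stdTuple_fst, stdTuple_snd, stdTuple_snd, coroot_single, if_neg hij, zero_add]

theorem changesBlock_stdTuple {N p : ℕ} (ε : A N →+* ℂ) {b i : ℕ} (hi : i < p) :
    ChangesBlock p b (stdTuple ε (b * p + i)).1 := by
  by_cases h : b * p + i < N
  · intro w j hj
    have := stdTuple_fst ε ⟨b * p + i, h⟩ w
    simp only at this
    rw [this, Pi.sub_apply, Pi.smul_apply, single_mem_blockSpace hi j hj, smul_zero, sub_zero]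
  · rw [stdTuple, dif_neg h]
    exact ChangesBlock.one

theorem Realizes.congr {N : ℕ} {ε : A N →+* ℂ} {t t' : ℕ → Op × (ℕ → ℂ)} (h : Realizes ε t)
    (h' : ∀ j < N, t' j = t j) : Realizes ε t' :=
  ⟨fun j => by rw [h' j j.2]; exact h.1 j,
    fun i j hij => by rw [h' j j.2, h' i i.2]; exact h.2 i j hij⟩

/-! ### Excluding the diagonal left matrix -/

/-- The left matrix of the braid of an iterated torus knot is never specialized to a diagonal
matrix whose diagonal entries are all `1` except for the first. -/
theorem PhiL_satellite_torus_ne_diagonal {n p : ℕ} (hn : 1 < n) (hp : 1 < p)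
    (ε : A (n * p) →+* ℂ) (d : Fin (n * p) → ℂ) (hd : ∀ i : Fin (n * p), (i : ℕ) ≠ 0 → d i = 1) :
    (PhiL (satellite (zero_lt_one.trans hn) (torus n (n + 1)) (torus p 1))).map ε ≠
      Matrix.diagonal d := by
  intro hΦ
  rw [satellite_torus] at hΦ
  have hpN : ∀ b i, b < n → i < p → b * p + i < n * p := fun b i hb hi => by
    have h1 : (b + 1) * p ≤ n * p := Nat.mul_le_mul_right p hb
    have h2 : (b + 1) * p = b * p + p := by ring
    omega
  have h0N := hpN 0
  obtain ⟨S, hST, hSx, hSn⟩ := exists_extension (n := n) (p := p) (by omega)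
    fun b i => stdTuple ε (b * p + i)
  set x : ℕ → Op := fun k => blockProd (fun i => stdTuple ε (k % n * p + i)) 0 p with hxdef
  have hflat : ∀ j < n * p, flatten p S j = stdTuple ε j := fun j hj => by
    rw [flatten, hST _ (Nat.div_lt_of_lt_mul (by rwa [mul_comm]))]
    exact congrArg _ (by rw [mul_comm]; exact Nat.div_add_mod j p)
  have hs : Realizes ε (flatten p S) := (realizes_stdTuple ε).congr hflat
  have M1 := moves_rotate_pow (x := x) (by omega) (by omega) hSx hSn (n + 1)
  set R := flatten p fun b i => conjPair (leadProd x (n + 1)) (S (n + 1 + b) i) with hRdef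
  have hR := (M1 ε hs).1
  have hN : ∀ j : Fin (n * p), _ := ((M1.mul (moves_strandCross (a := 0) (l := p - 1)
    (by have := h0N (p - 1) (by omega) (by omega); omega) R)) ε hs).2
  -- The initial roots are the standard basis, so `hΦ` says that the final root in position i is d_i
  -- e_i.
  simp only [← Matrix.map_apply (f := ε), hΦ, hflat _ (Fin.is_lt _), stdTuple_snd,
    Matrix.diagonal_apply, ite_smul, zero_smul, Finset.sum_ite_eq, Finset.mem_univ, if_true,
    zero_le, true_and, zero_add] at hN
  have R1 : ∀ j < n * p, p ≤ j → (R j).2 = Pi.single j 1 := fun j hj hpj => by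
    have := hN ⟨j, hj⟩
    rwa [if_neg (by simp only; omega), if_neg (by simp only; omega),
      hd _ (by simp only; omega), one_smul] at this
  -- The crossing γ carries strand 0 unchanged to position p - 1, whose diagonal entry is 1 because
  -- p - 1 ≠ 0.
  have R2 : (R 0).2 = Pi.single (p - 1) 1 := by
    have := hN ⟨p - 1, by have := h0N (p - 1) (by omega) (by omega); omega⟩
    rwa [if_neg (by simp only; omega), if_pos rfl, hd _ (by simp only; omega),
      one_smul] at this
  have hsingle : ∀ i < p, Pi.single i (1 : ℂ) ∈ blockSpace p 0 := fun i hi => by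
    simpa using single_mem_blockSpace (b := 0) hi
  -- The reflection of R 0 changes the root of R (i + 1) by a multiple of e_{p-1} and yields d_i
  -- e_i, so that root is a combination of e_i and e_{p-1}.
  have R3 : ∀ i < p, (R i).2 ∈ blockSpace p 0 := by
    intro i hi
    rcases i with _ | i
    · rw [R2]; exact hsingle _ (by omega)
    have h1 := hN ⟨i, by have := h0N i (by omega) (by omega); omega⟩
    rw [if_pos (show i < p - 1 by omega)] at h1
    have h2 := hR.2 ⟨i + 1, by have := h0N (i + 1) (by omega) (by omega); omega⟩
      ⟨0, by have := h0N 0 (by omega) (by omega); omega⟩ (by simp)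
    simp only [conjPair] at h1 h2
    rw [h1, eq_sub_iff_add_eq] at h2
    rw [← h2, R2]
    exact Submodule.add_mem _ (Submodule.smul_mem _ _ (hsingle _ (by omega)))
      (Submodule.smul_mem _ _ (hsingle _ (by omega)))
  have hx0 : x n = x 0 := by simp [hxdef]
  have hlead : leadProd x (n + 1) = leadProd x n * x 0 := by rw [leadProd, hx0]
  have R4 : ∀ b i, b + 1 < n → i < p → (R (b * p + i)).2 =
      leadProd x n (x 0 ((x (b + 1))⁻¹ (Pi.single ((b + 1) * p + i) 1))) := by
    intro b i hb hi
    rw [hRdef, flatten_apply _ _ hi, show n + 1 + b = b + 1 + n by omega]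
    simp only [conjPair, hSn (b + 1), hlead, hST _ hb, stdTuple_snd, LinearEquiv.mul_apply]
    rfl
  have R5 : ∀ i < p, (R ((n - 1) * p + i)).2 =
      leadProd x n ((x 0)⁻¹ (Pi.single (0 * p + i) 1)) := by
    intro i hi
    -- The last block has index 2n in `S`, so block 0 has made two turns and carries x_0⁻². Together
    -- with the prefix L x_0 this leaves L x_0⁻¹.
    rw [hRdef, flatten_apply _ _ hi, show n + 1 + (n - 1) = 0 + n + n by omega]
    have e1 := hSn (0 + n) i
    rw [hSn 0 i, hST 0 (by omega)] at e1
    change _ = conjPair (x (0 + n))⁻¹ (conjPair (x 0)⁻¹ (stdTuple ε (0 * p + i))) at e1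
    rw [zero_add, hx0] at e1
    simp only [zero_add n, conjPair, e1, hlead, stdTuple_snd]
    simp
  have hnp : ∀ b, 0 < b → p ≤ b * p := fun b hb => Nat.le_mul_of_pos_left p hb
  have hcyc : BlockCycle p n x := by
    have hch : ∀ b < n, ChangesBlock p b (x b) := fun b hb => by
      refine ChangesBlock.blockProd fun j hj => ?_
      simp only [Nat.mod_eq_of_lt hb, zero_add]
      exact changesBlock_stdTuple ε hj
    refine ⟨hch, fun w hw => ?_, fun b hb w hw => ?_⟩
    · have := map_mem_of_single (by omega) (leadProd x n * (x 0)⁻¹) (blockSpace p (n - 1))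
        (fun i hi => by
          rw [LinearEquiv.mul_apply, ← R5 i hi, R1 _ (hpN _ _ (by omega) hi)
            ((hnp _ (by omega)).trans (Nat.le_add_right _ _))]
          exact single_mem_blockSpace hi) ((hch 0 (by omega)).apply_mem hw)
      simpa using this
    · have := map_mem_of_single (by omega) (leadProd x n * x 0 * (x (b + 1))⁻¹) (blockSpace p b)
        (fun i hi => by
          rw [LinearEquiv.mul_apply, LinearEquiv.mul_apply, ← R4 b i hb hi]
          rcases Nat.eq_zero_or_pos b with rfl | h0
          · simpa using R3 i hi
          rw [R1 _ (hpN _ _ (by omega) hi) ((hnp _ h0).trans (Nat.le_add_right _ _))]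
          exact single_mem_blockSpace hi) ((hch _ hb).apply_mem hw)
      simpa using this
  have hret := hcyc.return_eq hn (f := fun b => Pi.single (b * p + 0) 1)
    (fun b _ => single_mem_blockSpace (by omega))
    (by
      rw [← R5 0 (by omega), R1 _ (hpN _ _ (by omega) (by omega))
        ((hnp _ (by omega)).trans (Nat.le_add_right _ _))])
    (fun b h0 hb => by
      rw [← R4 b 0 hb (by omega), R1 _ (hpN _ _ (by omega) (by omega))
        ((hnp _ h0).trans (Nat.le_add_right _ _))])
  have := R4 0 0 (by omega) (by omega)
  simp only [zero_add, zero_mul, add_zero] at this hret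
  rw [hret, R2] at this
  -- Now e_{p-1} = (-1)^{n-1} e_0; the coordinate 0 is zero on the left only.
  have := congrFun this 0
  rw [Pi.single_eq_of_ne (by omega), Pi.smul_apply, Pi.single_eq_same, smul_eq_mul,
    mul_one] at this
  exact pow_ne_zero _ (neg_ne_zero.2 one_ne_zero) this.symm

/-! ### Augmentations of full rank -/

/-- The first diagonal entry of an augmentation of full rank is the only one that can differ
from `1`. -/
theorem exists_map_PhiL_eq_diagonal {N : ℕ} (β : BraidGroup N) (ε : AR N →+* ℂ)
    (hε : IsAugmentation β ε) (hr : augRank ε = N) :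
    ∃ d : Fin N → ℂ, (∀ i : Fin N, (i : ℕ) ≠ 0 → d i = 1) ∧
      (PhiL β).map (ε.comp (inA N)) = Matrix.diagonal d := by
  set l := ε (inR N (lamMu 1 (writhe β))) with hl
  have hΛ : (matLam β).map ε = Matrix.diagonal fun i : Fin N => if (i : ℕ) = 0 then l else 1 := by
    rw [matLam, Matrix.diagonal_map (map_zero ε)]
    simp [apply_ite ε, hl]
  have hA : IsUnit ((matA N).map ε) := by
    rw [← Matrix.mulVec_surjective_iff_isUnit]
    have : LinearMap.range ((matA N).map ε).mulVecLin = ⊤ := Submodule.eq_top_of_finrank_eq <| by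
      rw [Module.finrank_fin_fun]
      exact hr
    exact LinearMap.range_eq_top.1 this
  have hrel : (matA N).map ε =
      (matLam β).map ε * (PhiL β).map (ε.comp (inA N)) * (matA N).map ε := by
    ext i j
    have := hε _ (TwoSidedIdeal.subset_span (Or.inl ⟨i, j, rfl⟩))
    rw [Matrix.sub_apply, map_sub, sub_eq_zero] at this
    rw [Matrix.map_apply, this, ← Matrix.map_apply (f := ε), Matrix.map_mul, Matrix.map_mul,
      Matrix.map_map]
    rfl
  -- Cancelling the invertible ε(𝐀) from ε(𝐀) = ε(Λ) ε(Φ^L) ε(𝐀) leaves ε(Λ) ε(Φ^L) = 1.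
  have h1 : (matLam β).map ε * (PhiL β).map (ε.comp (inA N)) = 1 :=
    hA.mul_right_cancel (by rw [← hrel, one_mul])
  rw [hΛ] at h1
  refine ⟨fun i => if (i : ℕ) = 0 then l⁻¹ else 1, fun i hi => if_neg hi, ?_⟩
  have hl0 : IsUnit (lamMu 1 (writhe β)) :=
    ((LaurentPolynomial.isUnit_T _).map _).mul (LaurentPolynomial.isUnit_T _)
  have hl' : l ≠ 0 := ((hl0.map (inR N)).map ε).ne_zero
  rw [← Matrix.inv_eq_right_inv h1]
  refine Matrix.inv_eq_right_inv ?_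
  rw [Matrix.diagonal_mul_diagonal, ← Matrix.diagonal_one]
  congr 1
  funext i
  split_ifs <;> simp [hl']

end CordAlgebra

theorem mainTheorem3 (n p : ℕ) (hn : 1 < n) (hp : 1 < p) :
    CordAlgebra.ar (BraidGroup.satellite (zero_lt_one.trans hn)
        (BraidGroup.torus n (n + 1)) (BraidGroup.torus p 1)) < n * p ∧
      ¬ ∃ ε : CordAlgebra.A (n * p) →+* ℂ,
        (CordAlgebra.PhiL (BraidGroup.satellite (zero_lt_one.trans hn)
            (BraidGroup.torus n (n + 1)) (BraidGroup.torus p 1))).map ε =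
          CordAlgebra.matDelta (BraidGroup.satellite (zero_lt_one.trans hn)
            (BraidGroup.torus n (n + 1)) (BraidGroup.torus p 1)) := by
  have hnp : 0 < n * p := Nat.mul_pos (by omega) (by omega)
  constructor
  · rw [CordAlgebra.ar]
    generalize hβ : BraidGroup.satellite (zero_lt_one.trans hn)
      (BraidGroup.torus n (n + 1)) (BraidGroup.torus p 1) = β
    rcases Set.eq_empty_or_nonempty (CordAlgebra.augRanks β) with he | he
    -- Without augmentations the supremum is 0 by convention, which is still below np. Otherwise the
    -- bounded supremum is attained.
    · rw [he, csSup_empty, Nat.bot_eq_zero]; exact hnp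
    obtain ⟨ε, hε, -, hr⟩ := Nat.sSup_mem he (CordAlgebra.augRanks_bddAbove β)
    rw [← hr]
    refine lt_of_le_of_ne ?_ fun hN => ?_
    · simpa [CordAlgebra.augRank] using ((CordAlgebra.matA (n * p)).map ε).rank_le_card_width
    · obtain ⟨d, hd, h⟩ := CordAlgebra.exists_map_PhiL_eq_diagonal β ε hε hN
      subst hβ
      exact CordAlgebra.PhiL_satellite_torus_ne_diagonal hn hp _ d hd h
  · rintro ⟨ε, h⟩
    exact CordAlgebra.PhiL_satellite_torus_ne_diagonal hn hp ε _ (fun i hi => if_neg hi) h
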